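/- Let $d\ge 1$ and let $X=(X_1,\dots,X_d)$ be a random vector in $\mathbb R^d$ with i.i.d. centered coordinates ($\mathbb E X_1=0$) which is infinitely divisible without Gaussian component: for some $\gamma\in\mathbb R^d$ and all $t\in\mathbb R^d$, $$\mathbb E e^{i\langle t,X\rangle}=\exp\Big\{i\langle t,\gamma\rangle+\int_{\mathbb R^d}\big(e^{i\langle t,u\rangle}-1-i\langle t,u\rangle\mathbf 1_{\|u\|_2\le 1}\big)\,\nu(du)\Big\},$$ where $\nu$ is carried by the coordinate axes, its restriction to each axis being a copy of one and the same one-dimensional Lévy measure $\tilde\nu$, that is, a nonzero Borel measure on $\mathbb R$ with $\tilde\nu(\{0\})=0$ and $\int (1\wedge u^2)\,\tilde\nu(du)<\infty$. Assume that $\mathbb E e^{t\|X\|_2}<\infty$ for some $t>0$ and let $M=\sup\{t>0:\mathbb E e^{t|X_1|}<\infty\}\in(0,\infty]$. Let $\mathcal S$ be a linear subspace of $\mathbb R^d$, let $\Pi_{\mathcal S}$ be the orthogonal projection on $\mathcal S$, and let $\varepsilon>0$. For $0\le t<M$ put $$h(t)=8\int_{\mathbb R}|u|\,(e^{t|u|}-1)\,\tilde\nu(du)+\frac{2}{\varepsilon^2\,\mathbb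 E X_1^2}\int_{\mathbb R}|u|^3\,(e^{t|u|}-1)\,\tilde\nu(du),$$ a function which does not depend on $d$ or $\mathcal S$. Then both integrals are finite for all $0\le t<M$, the function $h$ is a strictly increasing bijection from $[0,M)$ onto $[0,h(M^-))$, where $h(M^-)=\lim_{t\uparrow M}h(t)\in(0,\infty]$, and, with $h^{-1}$ denoting its inverse, for all $0<x<h(M^-)$, $$\mathbb P\Big(\|\Pi_{\mathcal S}X\|_2\ \ge\ (1+\varepsilon)\sqrt{\mathbb E\|\Pi_{\mathcal S}X\|_2^2}+x\Big)\le \exp\Big(-\int_0^x h^{-1}(s)\,ds\Big)$$ and $$\mathbb P\Big(\|\Pi_{\mathcal S}X\|_2\ \le\ (1-\varepsilon)\sqrt{\mathbb E\|\Pi_{\mathcal S}X\|_2^2}-x\Big)\le \exp\Big(-\int_0^x h^{-1}(s)\,ds\Big).$$ -/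

import Mathlib

open MeasureTheory ProbabilityTheory Set

noncomputable section

namespace IDConcentration

/-- A (nonzero) Lévy measure on a Euclidean space `E`: a nonzero Borel measure without atom at the
origin for which `∫ min 1 ‖u‖² dν < ∞`. -/
structure IsLevyMeasure {E : Type*} [NormedAddCommGroup E] [MeasurableSpace E]
    (ν : Measure E) : Prop where
  ne_zero : ν ≠ 0
  zero_atom : ν {0} = 0
  lintegral_lt_top : ∫⁻ u, ENNReal.ofReal (min 1 (‖u‖ ^ 2)) ∂ν < ⊤

/-- The exponent `i⟨t, γ⟩ + ∫ (e^{i⟨t, u⟩} - 1 - i⟨t, u⟩ 1_{‖u‖ ≤ 1}) ν(du)` of an infinitely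
divisible law without Gaussian component. -/
def levyExponent {E : Type*} [NormedAddCommGroup E] [InnerProductSpace ℝ E] [MeasurableSpace E]
    (γ : E) (ν : Measure E) (t : E) : ℂ :=
  Complex.I * ((inner ℝ t γ : ℝ) : ℂ) +
    ∫ u, (Complex.exp (Complex.I * ((inner ℝ t u : ℝ) : ℂ)) - 1 -
      Set.indicator {v : E | ‖v‖ ≤ 1} (fun v => Complex.I * ((inner ℝ t v : ℝ) : ℂ)) u) ∂ν

/-- `μ` is the law `ID(γ, 0, ν)`: infinitely divisible, without Gaussian component, with
Lévy measure `ν`. -/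
structure IsID {E : Type*} [NormedAddCommGroup E] [InnerProductSpace ℝ E] [MeasurableSpace E]
    (μ : Measure E) (γ : E) (ν : Measure E) : Prop where
  isLevyMeasure : IsLevyMeasure ν
  charFun_eq : ∀ t : E, charFun μ t = Complex.exp (levyExponent γ ν t)

/-- The measure on `ℝ^d` supported by the coordinate axes whose part on each axis is a copy of the
one-dimensional measure `ν`, that is, the sum over `k` of the product measures
`δ₀ ⊗ ⋯ ⊗ ν ⊗ ⋯ ⊗ δ₀` with `ν` in position `k`. -/
def axisMeasure (d : ℕ) (ν : Measure ℝ) : Measure (EuclideanSpace ℝ (Fin d)) :=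
  ∑ k : Fin d, ν.map (fun u : ℝ => EuclideanSpace.single k u)

variable {Ω : Type*} [MeasurableSpace Ω]

/-- `M = sup {t > 0 : E e^{t|Y|} < ∞}`, an extended real number. -/
def expRadius (P : Measure Ω) (Y : Ω → ℝ) : EReal :=
  sSup ((fun t : ℝ => (t : EReal)) '' {t : ℝ | 0 < t ∧
    Integrable (fun ω => Real.exp (t * |Y ω|)) P})

/-- The real interval `[0, M)`, where `M` may be `∞`. -/
def ico (M : EReal) : Set ℝ := {t : ℝ | 0 ≤ t ∧ (t : EReal) < M}

/-- `h(t) = 8 ∫ |u| (e^{t|u|} - 1) ν(du) + 2 / (ε² E Y²) ∫ |u|³ (e^{t|u|} - 1) ν(du)`. It depends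
on the one-dimensional measure `ν`, on the scalar variable `Y` and on `ε`, not on a dimension. -/
def hFun (P : Measure Ω) (Y : Ω → ℝ) (ν : Measure ℝ) (ε t : ℝ) : ℝ :=
  8 * ∫ u, |u| * (Real.exp (t * |u|) - 1) ∂ν +
    2 / (ε ^ 2 * ∫ ω, Y ω ^ 2 ∂P) * ∫ u, |u| ^ 3 * (Real.exp (t * |u|) - 1) ∂ν

/-- The left limit `h(M⁻)`, an extended real number; since `h` is increasing on `[0, M)`, the left
limit at `M` is the supremum of `h` over `[0, M)`. -/
def leftLimit (h : ℝ → ℝ) (M : EReal) : EReal :=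
  sSup ((fun t : ℝ => ((h t : ℝ) : EReal)) '' ico M)

/-- The inverse `h⁻¹` of the restriction of `h` to `[0, M)`. -/
def inverseOn (h : ℝ → ℝ) (M : EReal) : ℝ → ℝ := Function.invFunOn h (ico M)

end IDConcentration

end

open Filter Topology

set_option linter.unusedSectionVars false

namespace IDConcentration

/-! An infinitely divisible law without Gaussian part is a limit of convolutions of many laws that
rarely jump. For one rare jump, hence by convolution and passage to the limit for the whole law, `E
e^f ≤ exp (E f + c)` holds as soon as the integral of `e^y - 1 - y` over the jumps is at most `c` at
every point, `y` being the increment of `f` caused by the jump (`integral_exp_le_of_isID`).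

Let `m² = E‖ΠX‖²`. The bound is applied to `±t F` (truncated from above), where `F = max(‖ΠX‖, εm)`.
The floor `εm` keeps the norm away from its singularity at the origin, so that the squared
increments of `F` along the axes sum to at most `u²(8 + K u²)/4` with `K = 2/(ε² E X₁²)`, whatever
the dimension and the subspace. Since `(e^y - 1 - y)/y²` increases, one may take `c = W(t)/4` with
`W(t) = ∫ (8 + K u²)(e^{t|u|} - 1 - t|u|) ν(du)`. The derivative of `W` is `h`, so Chernoff's bound
at `t = h⁻¹(x)` has exponent `x t - W(t)`, at least `∫₀ˣ h⁻¹` by Young's equality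
(`integral_inverseOn_le`).

It remains to compare `E F` with `m`. Above, `E F ≤ (1 + ε) m`. Below, `E F ≥ m - v/(4m)` with `v =
∫ (8 + K u²) u² dν`, by a variance bound for `‖ΠX‖²`. The loss is paid by the unused `3W/4`; when it
cannot be, `t m ≤ 2/3` and Cantelli's inequality is enough (`tails_norm_starProjection`).

Moments pass between `X₁` and `ν` through the zero bias identity `zeroBias μ = μ ∗ zeroBias ν`
(`IsID.zeroBias_eq_conv`), which is the equation `φ' = φ ψ'` for `φ = e^ψ`. -/

/-- The second order remainder `e^y - 1 - y` of the exponential. -/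
noncomputable def expRem (y : ℝ) : ℝ := Real.exp y - 1 - y

lemma expRem_nonneg (y : ℝ) : 0 ≤ expRem y := by
  have := Real.add_one_le_exp y
  unfold expRem; linarith

@[fun_prop]
lemma continuous_expRem : Continuous expRem := by unfold expRem; fun_prop

@[simp]
lemma expRem_zero : expRem 0 = 0 := by simp [expRem]

lemma convexOn_expRem : ConvexOn ℝ univ expRem := by
  have h : expRem = fun y => Real.exp y + (-1 + -1 * y) := by
    funext y; unfold expRem; ring
  rw [h]
  refine convexOn_exp.add ⟨convex_univ, ?_⟩
  intro x _ y _ a b _ _ hab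
  simp only [smul_eq_mul]
  nlinarith

/-! ### Elementary estimates for complex exponentials. -/

lemma norm_pow_sub_pow_le_mul {a b : ℂ} (ha : ‖a‖ ≤ 1) (hb : ‖b‖ ≤ 1) (n : ℕ) :
    ‖a ^ n - b ^ n‖ ≤ n * ‖a - b‖ := by
  induction n with
  | zero => simp
  | succ n ih =>
    have : a ^ (n + 1) - b ^ (n + 1) = a ^ n * (a - b) + (a ^ n - b ^ n) * b := by ring
    rw [this]
    refine (norm_add_le _ _).trans ?_
    rw [norm_mul, norm_mul, norm_pow]
    have h1 : ‖a‖ ^ n ≤ 1 := pow_le_one₀ (norm_nonneg _) ha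
    have h2 := norm_nonneg (a - b)
    have h3 := norm_nonneg (a ^ n - b ^ n)
    push_cast
    nlinarith [norm_nonneg b]

/-- Quantitative form of `(1 + z / N) ^ N → exp z` in the closed left half plane. -/
lemma norm_one_add_div_pow_sub_exp_le {z : ℂ} {N : ℕ} (hN : 0 < N) (hz : z.re ≤ 0)
    (h1 : ‖1 + z / N‖ ≤ 1) (h2 : ‖z / N‖ ≤ 1) :
    ‖(1 + z / N) ^ N - Complex.exp z‖ ≤ ‖z‖ ^ 2 / N := by
  have hN' : (0 : ℝ) < N := by exact_mod_cast hN
  have hNc : (N : ℂ) ≠ 0 := by exact_mod_cast hN.ne'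
  have he : Complex.exp z = Complex.exp (z / N) ^ N := by
    rw [← Complex.exp_nat_mul, mul_div_cancel₀ _ hNc]
  have hb : ‖Complex.exp (z / N)‖ ≤ 1 := by
    rw [Complex.norm_exp, Real.exp_le_one_iff, Complex.div_natCast_re]
    exact div_nonpos_of_nonpos_of_nonneg hz hN'.le
  rw [he]
  refine (norm_pow_sub_pow_le_mul h1 hb N).trans ?_
  have h3 := Complex.norm_exp_sub_one_sub_id_le h2
  rw [← norm_neg] at h3
  have h4 : -(Complex.exp (z / N) - 1 - z / N) = 1 + z / N - Complex.exp (z / N) := by ring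
  rw [h4] at h3
  calc (N : ℝ) * ‖1 + z / N - Complex.exp (z / N)‖ ≤ N * ‖z / N‖ ^ 2 := by gcongr
    _ = ‖z‖ ^ 2 / N := by
      rw [norm_div, Complex.norm_natCast]; field_simp

lemma norm_exp_I_mul_sub_one_sub_le (y : ℝ) :
    ‖Complex.exp (Complex.I * y) - 1 - Complex.I * y‖ ≤ 2 * y ^ 2 := by
  have hn : ‖Complex.I * (y : ℂ)‖ = |y| := by simp
  rcases le_or_gt |y| 1 with h | h
  · have := Complex.norm_exp_sub_one_sub_id_le (x := Complex.I * y) (by rw [hn]; exact h)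
    rw [hn, sq_abs] at this
    nlinarith [sq_nonneg y]
  · have h1 := Real.norm_exp_I_mul_ofReal_sub_one_le (x := y)
    have h2 := norm_sub_le (Complex.exp (Complex.I * y) - 1) (Complex.I * y)
    rw [hn] at h2
    rw [Real.norm_eq_abs] at h1
    nlinarith [sq_abs y]

/-! ### The Lévy–Khintchine integrand and the removal of small jumps. -/

section Approximation

variable {E : Type*} [NormedAddCommGroup E] [InnerProductSpace ℝ E] [FiniteDimensional ℝ E]
  [MeasurableSpace E] [BorelSpace E]

/-- The integrand of the Lévy–Khintchine exponent. -/
noncomputable def levyIntegrand (t u : E) : ℂ :=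
  Complex.exp (Complex.I * ((inner ℝ t u : ℝ) : ℂ)) - 1 -
      Set.indicator {v : E | ‖v‖ ≤ 1} (fun v => Complex.I * ((inner ℝ t v : ℝ) : ℂ)) u

lemma levyExponent_eq (γ : E) (ν : Measure E) (t : E) : levyExponent γ ν t =
    Complex.I * ((inner ℝ t γ : ℝ) : ℂ) + ∫ u, levyIntegrand t u ∂ν := rfl

lemma measurable_levyIntegrand (t : E) : Measurable (levyIntegrand t) := by
  unfold levyIntegrand
  refine Measurable.sub (by fun_prop) (Measurable.indicator (by fun_prop) ?_)
  exact measurableSet_le measurable_norm measurable_const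

lemma norm_levyIntegrand_le (t u : E) :
    ‖levyIntegrand t u‖ ≤ (2 + 2 * ‖t‖ ^ 2) * min 1 (‖u‖ ^ 2) := by
  unfold levyIntegrand
  by_cases hu : ‖u‖ ≤ 1
  · rw [Set.indicator_of_mem (by exact hu), min_eq_right (by nlinarith [norm_nonneg u])]
    refine (norm_exp_I_mul_sub_one_sub_le _).trans ?_
    have h1 := abs_real_inner_le_norm t u
    have h2 : (inner ℝ t u : ℝ) ^ 2 ≤ (‖t‖ * ‖u‖) ^ 2 := sq_le_sq' (by
      linarith [neg_abs_le (inner ℝ t u : ℝ)]) ((le_abs_self _).trans h1)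
    nlinarith [sq_nonneg ‖u‖]
  · rw [Set.indicator_of_notMem (by exact hu), min_eq_left (by nlinarith), sub_zero]
    refine (norm_sub_le _ _).trans ?_
    rw [Complex.norm_exp_I_mul_ofReal]
    simp only [norm_one]
    nlinarith [sq_nonneg ‖t‖]

lemma IsLevyMeasure.integrable_min {ν : Measure E} (h : IsLevyMeasure ν) :
    Integrable (fun u => min 1 (‖u‖ ^ 2)) ν := by
  refine ⟨by fun_prop, ?_⟩
  rw [hasFiniteIntegral_iff_ofReal (Eventually.of_forall fun u => by positivity)]
  exact h.lintegral_lt_top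

lemma IsLevyMeasure.integrable_levyIntegrand {ν : Measure E} (h : IsLevyMeasure ν) (t : E) :
    Integrable (levyIntegrand t) ν :=
  (h.integrable_min.const_mul (2 + 2 * ‖t‖ ^ 2)).mono'
    (measurable_levyIntegrand t).aestronglyMeasurable
    (Eventually.of_forall fun u => norm_levyIntegrand_le t u)

/-- The jumps of size larger than `1 / (n + 1)`. -/
def largeJumps (E : Type*) [NormedAddCommGroup E] (n : ℕ) : Set E := {u | 1 / ((n : ℝ) + 1) < ‖u‖}

lemma measurableSet_largeJumps (n : ℕ) : MeasurableSet (largeJumps E n) :=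
  measurableSet_lt measurable_const measurable_norm

lemma IsLevyMeasure.measure_largeJumps_lt_top {ν : Measure E} (h : IsLevyMeasure ν) (n : ℕ) :
    ν (largeJumps E n) < ⊤ := by
  have hpos : (0 : ℝ) < min 1 ((1 / ((n : ℝ) + 1)) ^ 2) := by positivity
  refine (measure_mono ?_).trans_lt (h.integrable_min.measure_norm_ge_lt_top hpos)
  intro u hu
  have hu' : 1 / ((n : ℝ) + 1) < ‖u‖ := hu
  simp only [mem_ofPred_eq, Real.norm_eq_abs]
  rw [abs_of_nonneg (by positivity)]
  gcongr

/-- The sets of large jumps increase to the complement of the origin, where the integrand vanishes.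
-/
lemma IsLevyMeasure.tendsto_levyIntegral {ν : Measure E} (h : IsLevyMeasure ν) (t : E) :
    Tendsto (fun n => ∫ u in largeJumps E n, levyIntegrand t u ∂ν) atTop
      (𝓝 (∫ u, levyIntegrand t u ∂ν)) := by
  have hm : Monotone (largeJumps E) := by
    intro a b hab u hu
    have hu' : 1 / ((a : ℝ) + 1) < ‖u‖ := hu
    refine lt_of_le_of_lt ?_ hu'
    gcongr
  have hz : ∀ u ∉ ⋃ n, largeJumps E n, levyIntegrand t u = 0 := by
    intro u hu
    have : u = 0 := by
      by_contra hne
      obtain ⟨n, hn⟩ := exists_nat_one_div_lt (norm_pos_iff.mpr hne)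
      exact hu (mem_iUnion.mpr ⟨n, hn⟩)
    simp [this, levyIntegrand]
  rw [← setIntegral_eq_integral_of_forall_compl_eq_zero hz]
  exact tendsto_setIntegral_of_monotone (fun n => measurableSet_largeJumps n) hm
    (h.integrable_levyIntegrand t).integrableOn

end Approximation

/-! ### Laplace transform bounds for infinitely divisible laws. -/

section Concentration

variable {E : Type*} [NormedAddCommGroup E] [InnerProductSpace ℝ E] [FiniteDimensional ℝ E]
  [MeasurableSpace E] [BorelSpace E]

/-- The carré-du-champ type bound on the jumps of `f`. -/
def JumpBound (Λ : Measure E) (c : ℝ) (f : E → ℝ) : Prop :=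
  ∀ x, ∫⁻ u, ENNReal.ofReal (expRem (f (x + u) - f x)) ∂Λ ≤ ENNReal.ofReal c

/-- A Laplace transform bound for all bounded functions with controlled jumps. -/
def ExpConcentrated (Λ : Measure E) (c : ℝ) (μ : Measure E) (K : ℝ) : Prop :=
  ∀ f : E → ℝ, Measurable f → (∃ B, ∀ x, |f x| ≤ B) → JumpBound Λ c f →
    ∫ x, Real.exp (f x) ∂μ ≤ Real.exp (∫ x, f x ∂μ + K)

lemma integrable_of_abs_le {α : Type*} [MeasurableSpace α] {μ : Measure α} [IsFiniteMeasure μ]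
    {f : α → ℝ} (hf : Measurable f) {B : ℝ} (hB : ∀ x, |f x| ≤ B) : Integrable f μ :=
  Integrable.of_bound hf.aestronglyMeasurable B (Eventually.of_forall hB)

lemma integrable_exp_of_abs_le {α : Type*} [MeasurableSpace α] {μ : Measure α}
    [IsFiniteMeasure μ] {f : α → ℝ} (hf : Measurable f) {B : ℝ} (hB : ∀ x, |f x| ≤ B) :
    Integrable (fun x => Real.exp (f x)) μ := by
  refine Integrable.of_bound (hf.exp).aestronglyMeasurable (Real.exp B)
    (Eventually.of_forall fun x => ?_)
  rw [Real.norm_eq_abs, Real.abs_exp]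
  exact Real.exp_le_exp.mpr ((le_abs_self _).trans (hB x))

lemma measurable_integral_add {μ : Measure E} [IsFiniteMeasure μ] {f : E → ℝ}
    (hf : Measurable f) : Measurable (fun x => ∫ y, f (x + y) ∂μ) := by
  have : StronglyMeasurable (Function.uncurry fun x y : E => f (x + y)) := by
    apply Measurable.stronglyMeasurable
    unfold Function.uncurry
    fun_prop
  exact (this.integral_prod_right).measurable

lemma abs_integral_add_le {μ : Measure E} [IsProbabilityMeasure μ] {f : E → ℝ} {B : ℝ}
    (hB : ∀ x, |f x| ≤ B) (x : E) : |∫ y, f (x + y) ∂μ| ≤ B := by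
  have := norm_integral_le_of_norm_le_const (μ := μ) (f := fun y => f (x + y)) (C := B)
    (Eventually.of_forall fun y => hB _)
  simpa using this

/-- Jensen's inequality for the convex `expRem`, then Tonelli. This stability is what lets a
convolution be treated one factor at a time. -/
lemma JumpBound.average {Λ μ : Measure E} [SFinite Λ] [IsProbabilityMeasure μ] {c : ℝ}
    {f : E → ℝ} (hf : Measurable f) {B : ℝ} (hB : ∀ x, |f x| ≤ B) (h : JumpBound Λ c f) :
    JumpBound Λ c (fun x => ∫ y, f (x + y) ∂μ) := by
  intro x
  have hint : ∀ z, Integrable (fun y => f (z + y)) μ := fun z =>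
    integrable_of_abs_le (by fun_prop) (fun y => hB (z + y))
  have hD : ∀ u y, |f (x + y + u) - f (x + y)| ≤ 2 * B := fun u y => by
    refine (abs_sub _ _).trans ?_
    linarith [hB (x + y + u), hB (x + y)]
  have hDi : ∀ u, Integrable (fun y => f (x + y + u) - f (x + y)) μ := fun u =>
    integrable_of_abs_le (by fun_prop) (hD u)
  have hRi : ∀ u, Integrable (fun y => expRem (f (x + y + u) - f (x + y))) μ := fun u => by
    unfold expRem
    exact ((integrable_exp_of_abs_le (by fun_prop) (hD u)).sub (integrable_const _)).sub (hDi u)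
  have key : ∀ u, ENNReal.ofReal (expRem (∫ y, f (x + u + y) ∂μ - ∫ y, f (x + y) ∂μ))
      ≤ ∫⁻ y, ENNReal.ofReal (expRem (f (x + y + u) - f (x + y))) ∂μ := fun u => by
    rw [← ofReal_integral_eq_lintegral_ofReal (hRi u)
      (Eventually.of_forall fun y => expRem_nonneg _)]
    apply ENNReal.ofReal_le_ofReal
    rw [← integral_sub (hint _) (hint _)]
    have := convexOn_expRem.map_integral_le (μ := μ) continuous_expRem.continuousOn isClosed_univ
      (f := fun y => f (x + y + u) - f (x + y)) (by simp) (hDi u) (hRi u)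
    simpa [add_right_comm] using this
  calc ∫⁻ u, ENNReal.ofReal (expRem (∫ y, f (x + u + y) ∂μ - ∫ y, f (x + y) ∂μ)) ∂Λ
      ≤ ∫⁻ u, ∫⁻ y, ENNReal.ofReal (expRem (f (x + y + u) - f (x + y))) ∂μ ∂Λ :=
        lintegral_mono key
    _ = ∫⁻ y, ∫⁻ u, ENNReal.ofReal (expRem (f (x + y + u) - f (x + y))) ∂Λ ∂μ := by
        apply lintegral_lintegral_swap
        apply Measurable.aemeasurable
        unfold Function.uncurry
        have := continuous_expRem.measurable
        fun_prop
    _ ≤ ∫⁻ _, ENNReal.ofReal c ∂μ := lintegral_mono fun y => h (x + y)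
    _ = ENNReal.ofReal c := by simp

lemma JumpBound.translate {Λ : Measure E} {c : ℝ} {f : E → ℝ} (h : JumpBound Λ c f) (a : E) :
    JumpBound Λ c (fun x => f (a + x)) := by
  intro x
  simpa [add_assoc] using h (a + x)

lemma expConcentrated_dirac (Λ : Measure E) (c : ℝ) (a : E) :
    ExpConcentrated Λ c (Measure.dirac a) 0 := by
  intro f _ _ _
  simp

/-- Integrating out the second factor replaces `f` by its average `g`, at the cost `K₂`; `g`
satisfies the same jump bound, so the hypothesis on `μ₁` applies to it. -/
lemma ExpConcentrated.conv {Λ μ₁ μ₂ : Measure E} [SFinite Λ] [IsProbabilityMeasure μ₁]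
    [IsProbabilityMeasure μ₂] {c K₁ K₂ : ℝ} (h₁ : ExpConcentrated Λ c μ₁ K₁)
    (h₂ : ExpConcentrated Λ c μ₂ K₂) : ExpConcentrated Λ c (μ₁ ∗ μ₂) (K₁ + K₂) := by
  rintro f hf ⟨B, hB⟩ hJ
  rw [integral_conv (integrable_exp_of_abs_le hf hB), integral_conv (integrable_of_abs_le hf hB)]
  set g : E → ℝ := fun x => ∫ y, f (x + y) ∂μ₂ with hg
  have hgm : Measurable g := measurable_integral_add hf
  have hgB : ∀ x, |g x| ≤ B := abs_integral_add_le hB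
  have step : ∀ x, ∫ y, Real.exp (f (x + y)) ∂μ₂ ≤ Real.exp (g x) * Real.exp K₂ := fun x => by
    rw [← Real.exp_add]
    exact h₂ (fun y => f (x + y)) (by fun_prop) ⟨B, fun y => hB _⟩ (hJ.translate x)
  calc ∫ x, ∫ y, Real.exp (f (x + y)) ∂μ₂ ∂μ₁ ≤ ∫ x, Real.exp (g x) * Real.exp K₂ ∂μ₁ := by
        refine integral_mono_of_nonneg (Eventually.of_forall fun x => ?_)
          ((integrable_exp_of_abs_le hgm hgB).mul_const _) (Eventually.of_forall step)
        exact integral_nonneg fun y => (Real.exp_pos _).le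
    _ = (∫ x, Real.exp (g x) ∂μ₁) * Real.exp K₂ := integral_mul_const _ _
    _ ≤ Real.exp (∫ x, g x ∂μ₁ + K₁) * Real.exp K₂ := by
        gcongr
        exact h₁ g hgm ⟨B, hgB⟩ (hJ.average hf hB)
    _ = Real.exp (∫ x, g x ∂μ₁ + (K₁ + K₂)) := by rw [← Real.exp_add, add_assoc]

/-- The law which jumps according to `Λ / N` and stays at the origin otherwise. -/
noncomputable def jumpStep (Λ : Measure E) (N : ℕ) : Measure E :=
  ENNReal.ofReal (1 - Λ.real univ / N) • Measure.dirac 0 + ENNReal.ofReal (1 / N) • Λ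

variable {Λ : Measure E} [IsFiniteMeasure Λ] {N : ℕ}

lemma isProbabilityMeasure_jumpStep (hN : 0 < N) (hΛ : Λ.real univ ≤ N) :
    IsProbabilityMeasure (jumpStep Λ N) := by
  have hN' : (0 : ℝ) < N := by exact_mod_cast hN
  refine ⟨?_⟩
  simp only [jumpStep, Measure.coe_add, Measure.coe_smul, Pi.add_apply, Pi.smul_apply,
    measure_univ, smul_eq_mul, mul_one]
  rw [← ofReal_measureReal (μ := Λ), ← ENNReal.ofReal_mul (by positivity),
    ← ENNReal.ofReal_add _ (by positivity), ← ENNReal.ofReal_one]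
  · congr 1; ring
  · rw [sub_nonneg, div_le_one hN']; exact hΛ

lemma integral_jumpStep {F : Type*} [NormedAddCommGroup F] [NormedSpace ℝ F] [CompleteSpace F]
    (hN : 0 < N) (hΛ : Λ.real univ ≤ N)
    {g : E → F} (hg : Integrable g Λ) : ∫ x, g x ∂(jumpStep Λ N) =
      g 0 + (1 / N : ℝ) • ∫ u, (g u - g 0) ∂Λ := by
  have hN' : (0 : ℝ) < N := by exact_mod_cast hN
  have h0 : 0 ≤ 1 - Λ.real univ / N := by
    rw [sub_nonneg, div_le_one hN']; exact hΛ
  rw [jumpStep, integral_add_measure, integral_smul_measure, integral_smul_measure, integral_dirac,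
    ENNReal.toReal_ofReal h0, ENNReal.toReal_ofReal (by positivity),
    integral_sub hg (integrable_const _), integral_const]
  · rw [smul_sub, sub_smul, smul_smul, one_smul]
    have : Λ.real univ / N = 1 / N * Λ.real univ := by ring
    rw [this]; abel
  · exact (integrable_dirac (by simp [enorm_lt_top])).smul_measure ENNReal.ofReal_ne_top
  · exact hg.smul_measure ENNReal.ofReal_ne_top

/-- With `J` and `R` the integrals of the increment of `f` from the origin and of its `expRem`, the
mean of `e^f` is `e^{f 0} (1 + (J + R)/N)`, and the mean of `f` is `f 0 + J/N`. Since `R ≤ c`, the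
inequality `1 + y ≤ e^y` concludes. -/
lemma expConcentrated_jumpStep (hN : 0 < N) (hΛ : Λ.real univ ≤ N) {c : ℝ} (hc : 0 ≤ c) :
    ExpConcentrated Λ c (jumpStep Λ N) (c / N) := by
  rintro f hf ⟨B, hB⟩ hJ
  have hN' : (0 : ℝ) < N := by exact_mod_cast hN
  have hfi : Integrable f Λ := integrable_of_abs_le hf hB
  have hDi : Integrable (fun u => f u - f 0) Λ := hfi.sub (integrable_const _)
  have hDe : Integrable (fun u => Real.exp (f u - f 0)) Λ :=
    integrable_exp_of_abs_le (B := 2 * B) (by fun_prop) fun u => by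
      refine (abs_sub _ _).trans ?_
      linarith [hB u, hB 0]
  have hRi : Integrable (fun u => expRem (f u - f 0)) Λ := by
    unfold expRem
    exact (hDe.sub (integrable_const _)).sub hDi
  have hR : ∫ u, expRem (f u - f 0) ∂Λ ≤ c := by
    have := hJ 0
    simp only [zero_add] at this
    rw [← ofReal_integral_eq_lintegral_ofReal hRi
      (Eventually.of_forall fun y => expRem_nonneg _)] at this
    exact (ENNReal.ofReal_le_ofReal_iff hc).mp this
  rw [integral_jumpStep hN hΛ (integrable_exp_of_abs_le hf hB), integral_jumpStep hN hΛ hfi]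
  have he : ∫ u, (Real.exp (f u) - Real.exp (f 0)) ∂Λ =
      Real.exp (f 0) * (∫ u, (f u - f 0) ∂Λ + ∫ u, expRem (f u - f 0) ∂Λ) := by
    rw [← integral_add hDi hRi, ← integral_const_mul]
    refine integral_congr_ae (Eventually.of_forall fun u => ?_)
    simp only [expRem]
    have : Real.exp (f u) = Real.exp (f 0) * Real.exp (f u - f 0) := by
      rw [← Real.exp_add]; congr 1; ring
    rw [this]; ring
  rw [he]
  simp only [smul_eq_mul]
  set J := ∫ u, (f u - f 0) ∂Λ
  set R := ∫ u, expRem (f u - f 0) ∂Λ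
  have h1 : Real.exp (f 0 + 1 / N * J + c / N) =
      Real.exp (f 0) * Real.exp (1 / N * J + c / N) := by rw [← Real.exp_add, add_assoc]
  rw [h1]
  have h2 := Real.add_one_le_exp (1 / N * J + c / N)
  have h3 : (1 / N : ℝ) * R ≤ c / N := by
    rw [div_eq_mul_one_div c, mul_comm]; gcongr
  have h4 := Real.exp_pos (f 0)
  nlinarith

lemma integral_exp_sub_one (Λ : Measure E) [IsFiniteMeasure Λ] (t : E) :
    ∃ z : ℂ, z = ∫ u, (Complex.exp (Complex.I * ((inner ℝ t u : ℝ) : ℂ)) - 1) ∂Λ ∧ z.re ≤ 0 ∧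
      ‖z‖ ≤ 2 * Λ.real univ := by
  refine ⟨_, rfl, ?_, ?_⟩
  · have hi : Integrable (fun u => Complex.exp (Complex.I * ((inner ℝ t u : ℝ) : ℂ)) - 1) Λ := by
      refine Integrable.of_bound (by fun_prop) 2 (Eventually.of_forall fun u => ?_)
      refine (norm_sub_le _ _).trans ?_
      rw [Complex.norm_exp_I_mul_ofReal]; norm_num
    have := (integral_re hi).symm
    simp only [RCLike.re_eq_complex_re] at this
    rw [this]
    refine integral_nonpos fun u => ?_
    have : (Complex.exp (Complex.I * ((inner ℝ t u : ℝ) : ℂ))).re ≤ 1 :=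
      (Complex.re_le_norm _).trans (Complex.norm_exp_I_mul_ofReal _).le
    simpa using this
  · refine norm_integral_le_of_norm_le_const (Eventually.of_forall fun u => ?_)
    refine (norm_sub_le _ _).trans ?_
    rw [Complex.norm_exp_I_mul_ofReal]; norm_num

lemma charFun_jumpStep (hN : 0 < N) (hΛ : Λ.real univ ≤ N) (t : E) :
    charFun (jumpStep Λ N) t =
      1 + (∫ u, (Complex.exp (Complex.I * ((inner ℝ t u : ℝ) : ℂ)) - 1) ∂Λ) / N := by
  rw [charFun_apply, integral_jumpStep hN hΛ]
  · simp only [inner_zero_left, Complex.ofReal_zero, zero_mul, Complex.exp_zero]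
    rw [Complex.real_smul, Complex.ofReal_div, Complex.ofReal_one, Complex.ofReal_natCast,
      one_div_mul_eq_div]
    simp_rw [mul_comm _ Complex.I, real_inner_comm]
  · refine Integrable.of_bound (by fun_prop) 1 (Eventually.of_forall fun u => ?_)
    rw [mul_comm, Complex.norm_exp_I_mul_ofReal]

lemma exists_expConcentrated_pow (hN : 0 < N) (hΛ : Λ.real univ ≤ N) {c : ℝ} (hc : 0 ≤ c)
    (m : ℕ) : ∃ μ : Measure E, IsProbabilityMeasure μ ∧
      (∀ t, charFun μ t =
        (1 + (∫ u, (Complex.exp (Complex.I * ((inner ℝ t u : ℝ) : ℂ)) - 1) ∂Λ) / N) ^ m) ∧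
      ExpConcentrated Λ c μ (m * (c / N)) := by
  induction m with
  | zero =>
    refine ⟨Measure.dirac 0, inferInstance, fun t => by simp, ?_⟩
    simpa using expConcentrated_dirac Λ c (0 : E)
  | succ m ih =>
    obtain ⟨μ, hμ, hch, hconc⟩ := ih
    have := isProbabilityMeasure_jumpStep hN hΛ
    refine ⟨μ ∗ jumpStep Λ N, inferInstance, fun t => ?_, ?_⟩
    · rw [charFun_conv, hch, charFun_jumpStep hN hΛ, pow_succ]
    · have := hconc.conv (expConcentrated_jumpStep hN hΛ hc)
      convert this using 1
      push_cast; ring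

/-- A finite jump measure is approximated by laws that are concentrated. -/
lemma exists_expConcentrated_approx (Λ : Measure E) [IsFiniteMeasure Λ] {c : ℝ} (hc : 0 ≤ c)
    (γ : E) {δ : ℝ} (hδ : 0 < δ) : ∃ μ : Measure E, IsProbabilityMeasure μ ∧
      (∀ t, ‖charFun μ t - Complex.exp (levyExponent γ Λ t)‖ ≤ δ) ∧
      ExpConcentrated Λ c μ c := by
  set L := Λ.real univ with hL
  have hL0 : 0 ≤ L := measureReal_nonneg
  -- The exponent `z` has norm at most `2L`; this `N` gives both `‖z/N‖ ≤ 1` and the error bound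
  -- `‖z‖²/N ≤ δ`.
  obtain ⟨N, hN⟩ := exists_nat_gt (2 * L + (2 * L) ^ 2 / δ)
  have hq : 0 ≤ (2 * L) ^ 2 / δ := by positivity
  have hN' : (0 : ℝ) < N := by linarith
  have hN0 : 0 < N := by exact_mod_cast hN'
  have hΛ : Λ.real univ ≤ N := by linarith
  obtain ⟨μ, hμ, hch, hconc⟩ := exists_expConcentrated_pow hN0 hΛ hc N
  -- A finite jump measure needs no compensation: the integral of its small jumps goes into the
  -- drift.
  set a : E := γ - ∫ u in {v : E | ‖v‖ ≤ 1}, u ∂Λ with ha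
  refine ⟨Measure.dirac a ∗ μ, inferInstance, fun t => ?_, ?_⟩
  · have hexp : levyExponent γ Λ t = Complex.I * ((inner ℝ t a : ℝ) : ℂ) +
        ∫ u, (Complex.exp (Complex.I * ((inner ℝ t u : ℝ) : ℂ)) - 1) ∂Λ := by
      have hms : MeasurableSet {v : E | ‖v‖ ≤ 1} :=
        measurableSet_le measurable_norm measurable_const
      have hid : IntegrableOn (fun u : E => u) {v : E | ‖v‖ ≤ 1} Λ := by
        refine Integrable.of_bound (by fun_prop) 1 ?_
        filter_upwards [ae_restrict_mem hms] with u hu using hu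
      rw [levyExponent, integral_sub, integral_indicator hms, ha, inner_sub_right, ← integral_inner hid,
        integral_const_mul, integral_complex_ofReal]
      · push_cast; ring
      · refine Integrable.of_bound (by fun_prop) 2 (Eventually.of_forall fun u => ?_)
        refine (norm_sub_le _ _).trans ?_
        rw [Complex.norm_exp_I_mul_ofReal]; norm_num
      · rw [integrable_indicator_iff hms]
        exact ((hid.const_inner t).ofReal).const_mul _
    obtain ⟨z, hz, hre, hzn⟩ := integral_exp_sub_one Λ t
    have hjp := isProbabilityMeasure_jumpStep hN0 hΛ
    have h1 : ‖1 + z / N‖ ≤ 1 := by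
      rw [hz, ← charFun_jumpStep hN0 hΛ]; exact norm_charFun_le_one t
    have h2 : ‖z / N‖ ≤ 1 := by
      rw [norm_div, Complex.norm_natCast, div_le_one hN']; linarith
    have h3 := norm_one_add_div_pow_sub_exp_le hN0 hre h1 h2
    rw [hexp, charFun_conv, charFun_dirac, hch, ← hz, Complex.exp_add, real_inner_comm, mul_comm _ Complex.I, ← mul_sub,
      norm_mul, Complex.norm_exp_I_mul_ofReal, one_mul]
    refine h3.trans ?_
    rw [div_le_iff₀ hN']
    have h4 : ‖z‖ ^ 2 ≤ (2 * L) ^ 2 := by gcongr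
    have h5 : (2 * L) ^ 2 / δ < N := by linarith
    rw [div_lt_iff₀ hδ] at h5
    linarith
  · have := (expConcentrated_dirac Λ c a).conv hconc
    convert this using 1
    field_simp
    ring

/-- Laplace transform bound for infinitely divisible laws without Gaussian component. -/
theorem integral_exp_le_of_isID {μ : Measure E} [IsProbabilityMeasure μ] {γ : E} {ν : Measure E}
    (hμ : IsID μ γ ν) {f : E → ℝ} (hfc : Continuous f) {B : ℝ} (hB : ∀ x, |f x| ≤ B) {c : ℝ}
    (hc : 0 ≤ c) (hJ : JumpBound ν c f) :
    ∫ x, Real.exp (f x) ∂μ ≤ Real.exp (∫ x, f x ∂μ + c) := by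
  have hfin : ∀ n, IsFiniteMeasure (ν.restrict (largeJumps E n)) := fun n =>
    isFiniteMeasure_restrict.mpr (hμ.isLevyMeasure.measure_largeJumps_lt_top n).ne
  choose μs hprob hch hconc using fun n : ℕ =>
    exists_expConcentrated_approx (ν.restrict (largeJumps E n)) hc γ
      (δ := 1 / ((n : ℝ) + 1)) (by positivity)
  let ρ : ℕ → ProbabilityMeasure E := fun n => ⟨μs n, hprob n⟩
  let ρ₀ : ProbabilityMeasure E := ⟨μ, inferInstance⟩
  have hlim : Tendsto ρ atTop (𝓝 ρ₀) := by
    rw [ProbabilityMeasure.tendsto_iff_tendsto_charFun]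
    intro t
    simp only [ρ, ρ₀, ProbabilityMeasure.coe_mk]
    rw [hμ.charFun_eq]
    have h1 : Tendsto (fun n => levyExponent γ (ν.restrict (largeJumps E n)) t) atTop
        (𝓝 (levyExponent γ ν t)) :=
      (hμ.isLevyMeasure.tendsto_levyIntegral t).const_add _
    have h2 := (Complex.continuous_exp.tendsto _).comp h1
    have h3 : Tendsto (fun n => charFun (μs n) t -
        Complex.exp (levyExponent γ (ν.restrict (largeJumps E n)) t)) atTop (𝓝 0) :=
      squeeze_zero_norm (fun n => hch n t) tendsto_one_div_add_atTop_nhds_zero_nat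
    simpa using h3.add h2
  rw [ProbabilityMeasure.tendsto_iff_forall_integral_tendsto] at hlim
  have l1 := hlim (BoundedContinuousFunction.ofNormedAddCommGroup f hfc B hB)
  have l2 := hlim (BoundedContinuousFunction.ofNormedAddCommGroup (fun x => Real.exp (f x))
    (by fun_prop) (Real.exp B) (fun x => by
      rw [Real.norm_eq_abs, Real.abs_exp]
      exact Real.exp_le_exp.mpr ((le_abs_self _).trans (hB x))))
  simp only [BoundedContinuousFunction.coe_ofNormedAddCommGroup, ρ, ρ₀, ProbabilityMeasure.coe_mk] at l1 l2
  refine le_of_tendsto_of_tendsto' l2 ((Real.continuous_exp.tendsto _).comp (l1.add_const c))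
    fun n => ?_
  -- Restricting `ν` only decreases the jump integral, so the same `c` serves for every `n`.
  refine hconc n f hfc.measurable ⟨B, hB⟩ fun x => ?_
  exact (lintegral_mono' Measure.restrict_le_self le_rfl).trans (hJ x)

end Concentration

/-! ### The zero bias transform and compensated exponents. -/

section ZeroBias

/-- The law of `s * u` where `u` has density `u ^ 2` with respect to `κ` and `s` is uniform
on `[0, 1]`. -/
noncomputable def zeroBias (κ : Measure ℝ) : Measure ℝ :=
  ((κ.withDensity (fun u => ENNReal.ofReal (u ^ 2))).prod
    (volume.restrict (Icc (0 : ℝ) 1))).map (fun p => p.2 * p.1)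

variable {κ : Measure ℝ}

lemma isFiniteMeasure_withDensity_sq (hκ : Integrable (fun u => u ^ 2) κ) :
    IsFiniteMeasure (κ.withDensity (fun u => ENNReal.ofReal (u ^ 2))) :=
  isFiniteMeasure_withDensity_ofReal hκ.hasFiniteIntegral

lemma isFiniteMeasure_zeroBias (hκ : Integrable (fun u => u ^ 2) κ) :
    IsFiniteMeasure (zeroBias κ) := by
  have := isFiniteMeasure_withDensity_sq hκ
  unfold zeroBias
  infer_instance

lemma lintegral_zeroBias (hκ : Integrable (fun u => u ^ 2) κ) {G : ℝ → ℝ} (hG : Continuous G)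
    (hG0 : ∀ x, 0 ≤ G x) : ∫⁻ y, ENNReal.ofReal (G y) ∂(zeroBias κ) =
      ∫⁻ u, ENNReal.ofReal (u ^ 2 * ∫ s in (0 : ℝ)..1, G (s * u)) ∂κ := by
  have := isFiniteMeasure_withDensity_sq hκ
  have hGm := hG.measurable
  rw [zeroBias, lintegral_map (by fun_prop) (by fun_prop), lintegral_prod _ (by fun_prop),
    lintegral_withDensity_eq_lintegral_mul _ (by fun_prop) (by fun_prop)]
  refine lintegral_congr fun u => ?_
  simp only [Pi.mul_apply]
  rw [ENNReal.ofReal_mul (sq_nonneg u), intervalIntegral.integral_of_le zero_le_one,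
    ← integral_Icc_eq_integral_Ioc, ofReal_integral_eq_lintegral_ofReal]
  · exact (by fun_prop : Continuous fun s => G (s * u)).integrableOn_Icc
  · exact Eventually.of_forall fun s => hG0 _

/-- Averaging `e^{itsu}` over `s` gives `(e^{itu} - 1)/(itu)`, which turns the weight `u²` into `u`.
Up to a factor `i`, the right side is the derivative of `compExponent`. -/
lemma charFun_zeroBias (hκ : Integrable (fun u => u ^ 2) κ) (t : ℝ) :
    Complex.I * t * charFun (zeroBias κ) t =
      ∫ u : ℝ, (u : ℂ) * (Complex.exp (Complex.I * ((t * u : ℝ) : ℂ)) - 1) ∂κ := by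
  have := isFiniteMeasure_withDensity_sq hκ
  rw [charFun_apply_real, zeroBias, integral_map (by fun_prop) (by fun_prop), integral_prod,
    integral_withDensity_eq_integral_toReal_smul (by fun_prop) (by simp), ← integral_const_mul]
  · refine integral_congr_ae (Eventually.of_forall fun u => ?_)
    simp only
    rw [ENNReal.toReal_ofReal (sq_nonneg u), integral_Icc_eq_integral_Ioc,
      ← intervalIntegral.integral_of_le zero_le_one]
    by_cases h : t * u = 0
    · rcases mul_eq_zero.mp h with h | h <;> simp [h]
    · have hc : Complex.I * ((t * u : ℝ) : ℂ) ≠ 0 := by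
        simpa using h
      have h1 : ∀ s : ℝ, Complex.exp (t * ((s * u : ℝ) : ℂ) * Complex.I) =
          Complex.exp (Complex.I * ((t * u : ℝ) : ℂ) * s) := fun s => by
        congr 1; push_cast; ring
      simp_rw [h1]
      rw [integral_exp_mul_complex hc]
      have hu : (u : ℂ) ≠ 0 := by
        intro h0; apply h; rw [Complex.ofReal_eq_zero] at h0; simp [h0]
      have ht : (t : ℂ) ≠ 0 := by
        intro h0; apply h; rw [Complex.ofReal_eq_zero] at h0; simp [h0]
      simp only [Complex.ofReal_one, mul_one, Complex.ofReal_zero, mul_zero, Complex.exp_zero,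
        Complex.real_smul]
      push_cast
      field_simp
  · refine Integrable.of_bound (by fun_prop) 1 (Eventually.of_forall fun p => ?_)
    rw [← Complex.ofReal_mul, mul_comm, Complex.norm_exp_I_mul_ofReal]

/-- The compensated exponent `∫ (e^{itu} - 1 - itu) κ(du)`. -/
noncomputable def compExponent (κ : Measure ℝ) (t : ℝ) : ℂ :=
  ∫ u : ℝ, (Complex.exp (Complex.I * ((t * u : ℝ) : ℂ)) - 1 - Complex.I * ((t * u : ℝ) : ℂ)) ∂κ

lemma integrable_compExponent (hκ : Integrable (fun u => u ^ 2) κ) (t : ℝ) :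
    Integrable (fun u : ℝ => Complex.exp (Complex.I * ((t * u : ℝ) : ℂ)) - 1 -
      Complex.I * ((t * u : ℝ) : ℂ)) κ := by
  refine (hκ.const_mul (2 * t ^ 2)).mono' (by fun_prop) (Eventually.of_forall fun u => ?_)
  refine (norm_exp_I_mul_sub_one_sub_le _).trans (le_of_eq ?_)
  ring

lemma norm_compExponent_le (hκ : Integrable (fun u => u ^ 2) κ) (t : ℝ) :
    ‖compExponent κ t‖ ≤ 2 * t ^ 2 * ∫ u, u ^ 2 ∂κ := by
  rw [← integral_const_mul]
  refine norm_integral_le_of_norm_le (hκ.const_mul (2 * t ^ 2)) (Eventually.of_forall fun u => ?_)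
  refine (norm_exp_I_mul_sub_one_sub_le _).trans (le_of_eq ?_)
  ring

lemma hasDerivAt_compExponent (hκ : Integrable (fun u => u ^ 2) κ) (t : ℝ) :
    HasDerivAt (compExponent κ)
      (Complex.I * ∫ u : ℝ, (u : ℂ) * (Complex.exp (Complex.I * ((t * u : ℝ) : ℂ)) - 1) ∂κ) t := by
  rw [← integral_const_mul]
  refine (hasDerivAt_integral_of_dominated_loc_of_deriv_le (s := Metric.ball t 1)
    (F := fun (t : ℝ) (u : ℝ) => Complex.exp (Complex.I * ((t * u : ℝ) : ℂ)) - 1 -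
      Complex.I * ((t * u : ℝ) : ℂ))
    (F' := fun (t : ℝ) (u : ℝ) => Complex.I *
      ((u : ℂ) * (Complex.exp (Complex.I * ((t * u : ℝ) : ℂ)) - 1)))
    (bound := fun u => (|t| + 1) * u ^ 2)
    (Metric.ball_mem_nhds t one_pos) (Eventually.of_forall fun s => by fun_prop)
    (integrable_compExponent hκ t) (by fun_prop)
    (Eventually.of_forall fun u s hs => ?_) (hκ.const_mul _)
    (Eventually.of_forall fun u s hs => ?_)).2
  · rw [norm_mul, norm_mul, Complex.norm_I, one_mul, Complex.norm_real, Real.norm_eq_abs]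
    have h1 := Real.norm_exp_I_mul_ofReal_sub_one_le (x := s * u)
    rw [Real.norm_eq_abs, abs_mul] at h1
    have h2 : |s| ≤ |t| + 1 := by
      rw [Metric.mem_ball, Real.dist_eq] at hs
      have := abs_sub_abs_le_abs_sub s t
      linarith
    calc |u| * ‖Complex.exp (Complex.I * ((s * u : ℝ) : ℂ)) - 1‖ ≤ |u| * (|s| * |u|) := by gcongr
      _ = |s| * u ^ 2 := by rw [← sq_abs u]; ring
      _ ≤ (|t| + 1) * u ^ 2 := by gcongr
  · have h1 : HasDerivAt (fun s : ℝ => Complex.I * ((s * u : ℝ) : ℂ)) (Complex.I * (u : ℂ)) s := by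
      have := ((hasDerivAt_id s).mul_const u).ofReal_comp.const_mul Complex.I
      simpa using this
    have h2 := (h1.cexp.sub_const 1).sub h1
    exact h2.congr_deriv (by ring)

end ZeroBias

/-! ### Transfer of moments between a centered law and its Lévy measure. -/

section Levy

lemma inner_real_eq_mul (t u : ℝ) : (inner ℝ t u : ℝ) = t * u := by simp [mul_comm]

variable {μ ν : Measure ℝ} [IsProbabilityMeasure μ] {γ : ℝ}

lemma charFun_eq_one_add_compExponent
    (hμ1 : Integrable (fun x => x) μ) (hμ0 : ∫ x, x ∂μ = 0) (t : ℝ) :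
    charFun μ t = 1 + compExponent μ t := by
  have h1 : Integrable (fun u : ℝ => Complex.exp (Complex.I * ((t * u : ℝ) : ℂ))) μ := by
    refine Integrable.of_bound (by fun_prop) 1 (Eventually.of_forall fun p => ?_)
    rw [Complex.norm_exp_I_mul_ofReal]
  have h2 : Integrable (fun u : ℝ => Complex.I * ((t * u : ℝ) : ℂ)) μ :=
    ((hμ1.const_mul t).ofReal).const_mul _
  have h3 : ∫ u : ℝ, Complex.I * ((t * u : ℝ) : ℂ) ∂μ = 0 := by
    rw [integral_const_mul, integral_complex_ofReal, integral_const_mul, hμ0]; simp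
  have h4 : Integrable (fun u : ℝ => Complex.exp (Complex.I * ((t * u : ℝ) : ℂ)) - 1) μ :=
    h1.sub (integrable_const _)
  rw [compExponent, integral_sub h4 h2, integral_sub h1 (integrable_const _), h3, charFun_apply_real]
  simp only [integral_const, probReal_univ, one_smul, sub_zero, add_sub_cancel]
  congr 1; funext u; congr 1; push_cast; ring

/-- Drift and compensator are purely imaginary, so the real part of the exponent sees only the
cosine. -/
lemma lintegral_one_sub_cos (hν : IsLevyMeasure ν) (t : ℝ) :
    ∫⁻ u, ENNReal.ofReal (1 - Real.cos (t * u)) ∂ν =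
      ENNReal.ofReal (-(levyExponent γ ν t).re) := by
  have hi := hν.integrable_levyIntegrand t
  have hre : ∀ u : ℝ, (levyIntegrand t u).re = Real.cos (t * u) - 1 := by
    intro u
    have h0 : (Set.indicator {v : ℝ | ‖v‖ ≤ 1}
        (fun v : ℝ => Complex.I * ((inner ℝ t v : ℝ) : ℂ)) u).re = 0 := by
      by_cases h : u ∈ {v : ℝ | ‖v‖ ≤ 1}
      · rw [Set.indicator_of_mem h]; simp
      · rw [Set.indicator_of_notMem h]; simp
    rw [levyIntegrand, Complex.sub_re, h0, inner_real_eq_mul, mul_comm Complex.I, Complex.sub_re,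
      Complex.exp_ofReal_mul_I_re]
    simp
  have h2 := hi.re
  simp only [RCLike.re_eq_complex_re, hre] at h2
  rw [← ofReal_integral_eq_lintegral_ofReal]
  · congr 1
    have h3 := integral_re hi
    simp only [RCLike.re_eq_complex_re, hre] at h3
    rw [levyExponent_eq, Complex.add_re, ← h3, ← neg_inj, neg_neg, ← integral_neg]
    simp
  · exact h2.neg.congr (Eventually.of_forall fun u => by simp)
  · exact Eventually.of_forall fun u => by simpa using Real.cos_le_one (t * u)

/-- The Lévy measure of a square integrable law is square integrable. -/
lemma IsID.integrable_sq (hID : IsID μ γ ν) (hμ2 : Integrable (fun x => x ^ 2) μ)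
    (hμ1 : Integrable (fun x => x) μ) (hμ0 : ∫ x, x ∂μ = 0) : Integrable (fun u => u ^ 2) ν := by
  set V := ∫ x, x ^ 2 ∂μ with hV
  have hV0 : 0 ≤ V := integral_nonneg fun x => sq_nonneg x
  have hpi := Real.pi_pos
  set τ : ℕ → ℝ := fun n => 1 / ((n : ℝ) + 1) with hτ
  have hτ0 : Tendsto τ atTop (𝓝 0) := tendsto_one_div_add_atTop_nhds_zero_nat
  have hτpos : ∀ n, 0 < τ n := fun n => by positivity
  -- With `y = 2τ²V ≤ 1/2`, the bound `‖φ(τ)‖ ≥ 1 - y` gives a real part of the exponent at least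
  -- `-2y`; dividing by `τ²` leaves `4V`.
  have hbound : ∀ᶠ n in atTop,
      ∫⁻ u, ENNReal.ofReal ((1 - Real.cos (τ n * u)) / τ n ^ 2) ∂ν ≤ ENNReal.ofReal (4 * V) := by
    have hsmall : ∀ᶠ n in atTop, 2 * τ n ^ 2 * V ≤ 1 / 2 := by
      have : Tendsto (fun n => 2 * τ n ^ 2 * V) atTop (𝓝 (2 * 0 ^ 2 * V)) :=
        ((hτ0.pow 2).const_mul 2).mul_const V
      simp only [ne_eq, OfNat.ofNat_ne_zero, not_false_eq_true, zero_pow, mul_zero,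
        zero_mul] at this
      exact this.eventually_le_const (by norm_num)
    filter_upwards [hsmall] with n hn
    have h1 : ∀ u, ENNReal.ofReal ((1 - Real.cos (τ n * u)) / τ n ^ 2) =
        ENNReal.ofReal (1 / τ n ^ 2) * ENNReal.ofReal (1 - Real.cos (τ n * u)) := fun u => by
      rw [← ENNReal.ofReal_mul (by positivity)]; congr 1; ring
    simp_rw [h1]
    rw [lintegral_const_mul _ (by fun_prop), lintegral_one_sub_cos (γ := γ) hID.isLevyMeasure,
      ← ENNReal.ofReal_mul (by positivity)]
    apply ENNReal.ofReal_le_ofReal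
    have h2 : Real.exp ((levyExponent γ ν (τ n)).re) = ‖charFun μ (τ n)‖ := by
      rw [hID.charFun_eq, Complex.norm_exp]
    have h3 := norm_compExponent_le hμ2 (τ n)
    have h4 : 1 - 2 * τ n ^ 2 * V ≤ ‖charFun μ (τ n)‖ := by
      rw [charFun_eq_one_add_compExponent hμ1 hμ0]
      have := norm_sub_le (1 + compExponent μ (τ n)) (compExponent μ (τ n))
      rw [add_sub_cancel_right, norm_one] at this
      linarith
    set y := 2 * τ n ^ 2 * V with hy
    have hy0 : 0 ≤ y := by positivity
    have h5 : -(levyExponent γ ν (τ n)).re ≤ 2 * y := by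
      have hlog : (levyExponent γ ν (τ n)).re = Real.log ‖charFun μ (τ n)‖ := by
        rw [← h2, Real.log_exp]
      have hmono : Real.log (1 - y) ≤ Real.log ‖charFun μ (τ n)‖ :=
        Real.log_le_log (by linarith) h4
      have hl := Real.one_sub_inv_le_log_of_pos (x := 1 - y) (by linarith)
      have hinv : (1 - y)⁻¹ ≤ 1 + 2 * y := by
        rw [inv_le_comm₀ (by linarith) (by linarith), inv_le_iff_one_le_mul₀ (by linarith)]
        nlinarith
      rw [hlog]; linarith
    calc 1 / τ n ^ 2 * -(levyExponent γ ν (τ n)).re ≤ 1 / τ n ^ 2 * (2 * y) := by gcongr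
      _ = 4 * V := by
        have := (hτpos n).ne'
        rw [hy]; field_simp; ring
  -- Fatou's lemma with `1 - cos x ≥ 2x²/π²` for `|x| ≤ π`, which applies at each fixed `u` once `τ
  -- n` is small.
  have hfatou : ∫⁻ u, ENNReal.ofReal (2 / Real.pi ^ 2 * u ^ 2) ∂ν ≤ ENNReal.ofReal (4 * V) := by
    calc ∫⁻ u, ENNReal.ofReal (2 / Real.pi ^ 2 * u ^ 2) ∂ν
        ≤ ∫⁻ u, liminf (fun n => ENNReal.ofReal ((1 - Real.cos (τ n * u)) / τ n ^ 2)) atTop ∂ν := by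
          refine lintegral_mono fun u => ?_
          refine le_liminf_of_le (by isBoundedDefault) ?_
          have h1 : ∀ᶠ n in atTop, |τ n * u| ≤ Real.pi := by
            have : Tendsto (fun n => |τ n * u|) atTop (𝓝 |0 * u|) := (hτ0.mul_const u).abs
            rw [zero_mul, abs_zero] at this
            exact this.eventually_le_const hpi
          filter_upwards [h1] with n hn
          apply ENNReal.ofReal_le_ofReal
          have h2 := Real.cos_le_one_sub_mul_cos_sq hn
          rw [le_div_iff₀ (by have := hτpos n; positivity)]
          nlinarith
      _ ≤ liminf (fun n => ∫⁻ u, ENNReal.ofReal ((1 - Real.cos (τ n * u)) / τ n ^ 2) ∂ν) atTop :=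
          lintegral_liminf_le fun n => by fun_prop
      _ ≤ ENNReal.ofReal (4 * V) := liminf_le_of_frequently_le' hbound.frequently
  have hi : Integrable (fun u => 2 / Real.pi ^ 2 * u ^ 2) ν := by
    refine ⟨by fun_prop, ?_⟩
    rw [hasFiniteIntegral_iff_ofReal (Eventually.of_forall fun u => by positivity)]
    exact hfatou.trans_lt ENNReal.ofReal_lt_top
  refine (hi.const_mul (Real.pi ^ 2 / 2)).congr (Eventually.of_forall fun u => ?_)
  simp only
  field_simp

/-- Square integrability of `ν` allows the large jumps to be compensated as well, leaving a drift
`b`. Comparing derivatives at the origin identifies `b` with the mean, which is zero. -/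
lemma IsID.charFun_eq_exp_compExponent (hID : IsID μ γ ν) (hμ2 : Integrable (fun x => x ^ 2) μ)
    (hμ1 : Integrable (fun x => x) μ) (hμ0 : ∫ x, x ∂μ = 0) (t : ℝ) :
    1 + compExponent μ t = Complex.exp (compExponent ν t) := by
  have hν2 := hID.integrable_sq hμ2 hμ1 hμ0
  have hms : MeasurableSet {v : ℝ | ‖v‖ ≤ 1} := measurableSet_le measurable_norm measurable_const
  have hlarge : Integrable ({v : ℝ | ‖v‖ ≤ 1}ᶜ.indicator fun v => v) ν := by
    refine hν2.mono' ((measurable_id.indicator hms.compl).aestronglyMeasurable)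
      (Eventually.of_forall fun u => ?_)
    by_cases h : u ∈ {v : ℝ | ‖v‖ ≤ 1}
    · rw [Set.indicator_of_notMem (by simpa using h)]; simpa using sq_nonneg u
    · rw [Set.indicator_of_mem (by simpa using h)]
      have h' : 1 < |u| := by simpa using h
      rw [Real.norm_eq_abs, ← sq_abs]; nlinarith
  set b : ℝ := γ + ∫ u, {v : ℝ | ‖v‖ ≤ 1}ᶜ.indicator (fun v => v) u ∂ν with hb
  have hexp : ∀ s : ℝ, levyExponent γ ν s = Complex.I * ((s * b : ℝ) : ℂ) + compExponent ν s := by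
    intro s
    have h1 : ∀ u : ℝ, levyIntegrand s u = Complex.I * (s : ℂ) *
        (({v : ℝ | ‖v‖ ≤ 1}ᶜ.indicator (fun v => v) u : ℝ) : ℂ) +
        (Complex.exp (Complex.I * ((s * u : ℝ) : ℂ)) - 1 - Complex.I * ((s * u : ℝ) : ℂ)) := by
      intro u
      rw [levyIntegrand, inner_real_eq_mul]
      by_cases h : u ∈ {v : ℝ | ‖v‖ ≤ 1}
      · rw [Set.indicator_of_mem h, Set.indicator_of_notMem (by simpa using h), inner_real_eq_mul]
        simp
      · rw [Set.indicator_of_notMem h, Set.indicator_of_mem (by simpa using h)]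
        push_cast; ring
    have h2 : Integrable (fun u : ℝ => Complex.I * (s : ℂ) *
        (({v : ℝ | ‖v‖ ≤ 1}ᶜ.indicator (fun v => v) u : ℝ) : ℂ)) ν := hlarge.ofReal.const_mul _
    rw [levyExponent_eq]
    simp_rw [h1]
    rw [integral_add h2 (integrable_compExponent hν2 s),
      integral_const_mul, integral_complex_ofReal, inner_real_eq_mul, hb, compExponent]
    push_cast
    ring
  have hfun : ∀ s : ℝ, 1 + compExponent μ s =
      Complex.exp (Complex.I * ((s * b : ℝ) : ℂ) + compExponent ν s) := fun s => by
    rw [← charFun_eq_one_add_compExponent hμ1 hμ0, hID.charFun_eq, hexp]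
  have hlin : HasDerivAt (fun s : ℝ => Complex.I * ((s * b : ℝ) : ℂ)) (Complex.I * (b : ℂ)) 0 := by
    have := ((hasDerivAt_id (0 : ℝ)).mul_const b).ofReal_comp.const_mul Complex.I
    simpa using this
  have hd1 := (hasDerivAt_compExponent hμ2 0).const_add 1
  have hd2 := (hlin.add (hasDerivAt_compExponent hν2 0)).cexp
  have heq : (fun s : ℝ => 1 + compExponent μ s) = fun s : ℝ =>
      Complex.exp (((fun s : ℝ => Complex.I * ((s * b : ℝ) : ℂ)) + compExponent ν) s) :=
    funext hfun
  rw [heq] at hd1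
  have := hd1.unique hd2
  have hz : compExponent ν 0 = 0 := by simp [compExponent]
  simp only [zero_mul, Complex.ofReal_zero, mul_zero, Complex.exp_zero, sub_self, integral_zero,
    Pi.add_apply, hz, add_zero, one_mul] at this
  have hb0 : b = 0 := by simpa using this.symm
  rw [hfun, hb0]; simp

/-- The zero bias transform of a centered infinitely divisible law. -/
lemma IsID.zeroBias_eq_conv (hID : IsID μ γ ν) (hμ2 : Integrable (fun x => x ^ 2) μ)
    (hμ1 : Integrable (fun x => x) μ) (hμ0 : ∫ x, x ∂μ = 0) :
    zeroBias μ = μ ∗ zeroBias ν := by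
  have hν2 := hID.integrable_sq hμ2 hμ1 hμ0
  have := isFiniteMeasure_zeroBias hμ2
  have := isFiniteMeasure_zeroBias hν2
  apply Measure.ext_of_charFun
  -- The factor `it` in `charFun_zeroBias` can be cancelled only for `t ≠ 0`; continuity supplies
  -- the origin.
  refine Continuous.ext_on (s := {0}ᶜ) (dense_compl_singleton 0) continuous_charFun
    continuous_charFun fun t ht => ?_
  have ht' : Complex.I * (t : ℂ) ≠ 0 := by simpa using ht
  have heq : (fun s : ℝ => 1 + compExponent μ s) = fun s : ℝ => Complex.exp (compExponent ν s) :=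
    funext fun s => hID.charFun_eq_exp_compExponent hμ2 hμ1 hμ0 s
  have hd1 := (hasDerivAt_compExponent hμ2 t).const_add 1
  have hd2 := (hasDerivAt_compExponent hν2 t).cexp
  rw [heq] at hd1
  -- Both sides of `φ = e^ψ` are differentiated: `φ' = e^ψ ψ'`.
  have h := hd1.unique hd2
  rw [← charFun_zeroBias hμ2, ← charFun_zeroBias hν2,
    ← hID.charFun_eq_exp_compExponent hμ2 hμ1 hμ0,
    ← charFun_eq_one_add_compExponent hμ1 hμ0] at h
  rw [charFun_conv]
  apply mul_left_cancel₀ ht'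
  apply mul_left_cancel₀ Complex.I_ne_zero
  rw [h]; ring

/-- The two members of the zero bias identity have the same total mass. -/
lemma IsID.integral_sq (hID : IsID μ γ ν) (hμ2 : Integrable (fun x => x ^ 2) μ)
    (hμ1 : Integrable (fun x => x) μ) (hμ0 : ∫ x, x ∂μ = 0) :
    ∫ x, x ^ 2 ∂μ = ∫ u, u ^ 2 ∂ν := by
  have hν2 := hID.integrable_sq hμ2 hμ1 hμ0
  have := isFiniteMeasure_zeroBias hν2
  have h := congrArg (fun m => ∫⁻ y, ENNReal.ofReal ((fun _ : ℝ => (1 : ℝ)) y) ∂m)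
    (hID.zeroBias_eq_conv hμ2 hμ1 hμ0)
  have hc : ∫⁻ y, ENNReal.ofReal ((fun _ : ℝ => (1 : ℝ)) y) ∂(μ ∗ zeroBias ν) =
      ∫⁻ y, ENNReal.ofReal ((fun _ : ℝ => (1 : ℝ)) y) ∂(zeroBias ν) := by
    rw [Measure.lintegral_conv (by fun_prop)]; simp
  rw [hc, lintegral_zeroBias hμ2 continuous_const (by simp),
    lintegral_zeroBias hν2 continuous_const (by simp)] at h
  simp only [intervalIntegral.integral_const, sub_zero, smul_eq_mul, mul_one] at h
  rw [integral_eq_lintegral_of_nonneg_ae (Eventually.of_forall fun x => sq_nonneg x) (by fun_prop),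
    integral_eq_lintegral_of_nonneg_ae (Eventually.of_forall fun x => sq_nonneg x) (by fun_prop), h]

lemma sq_mul_integral_exp {t : ℝ} (ht : 0 < t) (u : ℝ) :
    u ^ 2 * ∫ s in (0 : ℝ)..1, Real.exp (t * |s * u|) =
      t⁻¹ * (|u| * (Real.exp (t * |u|) - 1)) := by
  rcases eq_or_ne u 0 with rfl | hu
  · simp
  have hu' : 0 < |u| := abs_pos.mpr hu
  have h1 : ∫ s in (0 : ℝ)..1, Real.exp (t * |s * u|) =
      ∫ s in (0 : ℝ)..1, Real.exp ((t * |u|) * s) := by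
    refine intervalIntegral.integral_congr fun s hs => ?_
    rw [uIcc_of_le zero_le_one] at hs
    rw [abs_mul, abs_of_nonneg hs.1, ← mul_assoc, mul_right_comm]
  rw [h1, intervalIntegral.integral_comp_mul_left (fun x => Real.exp x) (by positivity),
    integral_exp, ← sq_abs]
  simp only [mul_zero, mul_one, Real.exp_zero, smul_eq_mul]
  field_simp

/-- Up to the factor `1/t`, the integrals are those of `e^{t|y|}` against the zero bias measures. In
the convolution, `e^{t|x+y|} ≥ e^{-t|x|} e^{t|y|}` splits off the integral against `zeroBias ν`,
multiplied by a nonzero constant. -/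
lemma IsID.integrable_mul_exp (hID : IsID μ γ ν) (hμ2 : Integrable (fun x => x ^ 2) μ)
    (hμ1 : Integrable (fun x => x) μ) (hμ0 : ∫ x, x ∂μ = 0) {t : ℝ} (ht : 0 < t)
    (he : Integrable (fun x => |x| * (Real.exp (t * |x|) - 1)) μ) :
    Integrable (fun u => |u| * (Real.exp (t * |u|) - 1)) ν := by
  have hν2 := hID.integrable_sq hμ2 hμ1 hμ0
  have := isFiniteMeasure_zeroBias hν2
  have hpos : ∀ u : ℝ, 0 ≤ t⁻¹ * (|u| * (Real.exp (t * |u|) - 1)) := fun u => by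
    have : 1 ≤ Real.exp (t * |u|) := Real.one_le_exp (by positivity)
    have : 0 ≤ Real.exp (t * |u|) - 1 := by linarith
    positivity
  have hfin : ∫⁻ y, ENNReal.ofReal (Real.exp (t * |y|)) ∂(zeroBias μ) < ⊤ := by
    rw [lintegral_zeroBias hμ2 (by fun_prop) (fun x => (Real.exp_pos _).le)]
    simp_rw [sq_mul_integral_exp ht]
    rw [← hasFiniteIntegral_iff_ofReal (Eventually.of_forall hpos)]
    exact (he.const_mul _).hasFiniteIntegral
  rw [hID.zeroBias_eq_conv hμ2 hμ1 hμ0, Measure.lintegral_conv (by fun_prop)] at hfin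
  have hle : (∫⁻ x, ENNReal.ofReal (Real.exp (-(t * |x|))) ∂μ) *
      ∫⁻ y, ENNReal.ofReal (Real.exp (t * |y|)) ∂(zeroBias ν) < ⊤ := by
    rw [← lintegral_lintegral_mul (by fun_prop) (by fun_prop)]
    refine lt_of_le_of_lt (lintegral_mono fun x => lintegral_mono fun y => ?_) hfin
    rw [← ENNReal.ofReal_mul (Real.exp_pos _).le, ← Real.exp_add]
    apply ENNReal.ofReal_le_ofReal
    apply Real.exp_le_exp.mpr
    have h1 : |y| ≤ |x + y| + |x| := by
      have := abs_sub (x + y) x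
      simpa using this
    nlinarith
  have hne : ∫⁻ x, ENNReal.ofReal (Real.exp (-(t * |x|))) ∂μ ≠ 0 := by
    intro h0
    rw [lintegral_eq_zero_iff (by fun_prop)] at h0
    have : ∀ᵐ x ∂μ, False := by
      filter_upwards [h0] with x hx
      simp only [Pi.zero_apply, ENNReal.ofReal_eq_zero] at hx
      exact absurd hx (not_le.mpr (Real.exp_pos _))
    exact this.exists.elim fun _ h => h
  have hfin2 : ∫⁻ y, ENNReal.ofReal (Real.exp (t * |y|)) ∂(zeroBias ν) < ⊤ :=
    (ENNReal.lt_top_of_mul_ne_top_right hle.ne hne)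
  rw [lintegral_zeroBias hν2 (by fun_prop) (fun x => (Real.exp_pos _).le)] at hfin2
  simp_rw [sq_mul_integral_exp ht] at hfin2
  rw [← hasFiniteIntegral_iff_ofReal (Eventually.of_forall hpos)] at hfin2
  have hi : Integrable (fun u => t⁻¹ * (|u| * (Real.exp (t * |u|) - 1))) ν :=
    ⟨by fun_prop, hfin2⟩
  refine (hi.const_mul t).congr (Eventually.of_forall fun u => ?_)
  simp only
  field_simp

lemma integrable_sq_zeroBias {κ : Measure ℝ} (hκ : Integrable (fun u => u ^ 2) κ)
    (hκ4 : Integrable (fun u => u ^ 4) κ) : Integrable (fun y => y ^ 2) (zeroBias κ) ∧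
      ∫ y, y ^ 2 ∂(zeroBias κ) = (∫ u, u ^ 4 ∂κ) / 3 := by
  have hK : ∀ u : ℝ, u ^ 2 * ∫ s in (0 : ℝ)..1, (s * u) ^ 2 = u ^ 4 / 3 := fun u => by
    simp_rw [mul_pow]
    rw [intervalIntegral.integral_mul_const, integral_pow]
    norm_num; ring
  have h := lintegral_zeroBias hκ (G := fun y => y ^ 2) (by fun_prop) (fun x => sq_nonneg x)
  simp_rw [hK] at h
  have h4 : Integrable (fun u => u ^ 4 / 3) κ := hκ4.div_const 3
  have hn : ∀ u : ℝ, 0 ≤ u ^ 4 / 3 := fun u => by positivity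
  rw [← ofReal_integral_eq_lintegral_ofReal h4 (Eventually.of_forall hn)] at h
  refine ⟨⟨by fun_prop, ?_⟩, ?_⟩
  · rw [hasFiniteIntegral_iff_ofReal (Eventually.of_forall fun u => sq_nonneg u), h]
    exact ENNReal.ofReal_lt_top
  · rw [integral_eq_lintegral_of_nonneg_ae (Eventually.of_forall fun x => sq_nonneg x)
      (by fun_prop), h, ENNReal.toReal_ofReal (integral_nonneg hn), integral_div]

/-- Second moments of the zero bias identity; the cross term vanishes because `μ` is centered. -/
lemma IsID.integral_pow_four (hID : IsID μ γ ν) (hμ2 : Integrable (fun x => x ^ 2) μ)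
    (hμ1 : Integrable (fun x => x) μ) (hμ0 : ∫ x, x ∂μ = 0)
    (hμ4 : Integrable (fun x => x ^ 4) μ) (hν4 : Integrable (fun u => u ^ 4) ν) :
    ∫ x, x ^ 4 ∂μ = 3 * (∫ x, x ^ 2 ∂μ) ^ 2 + ∫ u, u ^ 4 ∂ν := by
  have hν2 := hID.integrable_sq hμ2 hμ1 hμ0
  have := isFiniteMeasure_zeroBias hν2
  obtain ⟨iμ, eμ⟩ := integrable_sq_zeroBias hμ2 hμ4
  obtain ⟨iν, eν⟩ := integrable_sq_zeroBias hν2 hν4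
  have i1 : Integrable (fun y : ℝ => y) (zeroBias ν) := by
    refine (iν.add (integrable_const (1 : ℝ))).mono' (by fun_prop) (Eventually.of_forall fun y => ?_)
    simp only [Pi.add_apply, Real.norm_eq_abs]
    nlinarith [sq_nonneg (|y| - 1), sq_abs y]
  have hmass : (zeroBias ν).real univ = ∫ x, x ^ 2 ∂μ := by
    have h := lintegral_zeroBias hν2 (G := fun _ => 1) (by fun_prop) (by simp)
    simp only [intervalIntegral.integral_const, sub_zero, smul_eq_mul, mul_one,
      ENNReal.ofReal_one, lintegral_const, one_mul] at h
    rw [Measure.real, h, hID.integral_sq hμ2 hμ1 hμ0,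
      integral_eq_lintegral_of_nonneg_ae (Eventually.of_forall fun x => sq_nonneg x) (by fun_prop)]
  have heq := hID.zeroBias_eq_conv hμ2 hμ1 hμ0
  have h1 : ∫ y, y ^ 2 ∂(zeroBias μ) =
      ∫ x, (x ^ 2 * (∫ x, x ^ 2 ∂μ) + 2 * (∫ y, y ∂(zeroBias ν)) * x + (∫ u, u ^ 4 ∂ν) / 3) ∂μ := by
    rw [heq] at iμ ⊢
    rw [integral_conv iμ]
    refine integral_congr_ae (Eventually.of_forall fun x => ?_)
    simp only
    have h2 : ∀ y : ℝ, (x + y) ^ 2 = x ^ 2 + 2 * x * y + y ^ 2 := fun y => by ring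
    simp_rw [h2]
    have h3 : Integrable (fun y : ℝ => x ^ 2 + 2 * x * y) (zeroBias ν) :=
      (integrable_const _).add (i1.const_mul _)
    rw [integral_add h3 iν, integral_add (integrable_const _) (i1.const_mul _), integral_const, integral_const_mul, eν,
      hmass, smul_eq_mul]
    ring
  have h3 : Integrable (fun x : ℝ => x ^ 2 * (∫ x, x ^ 2 ∂μ) + 2 * (∫ y, y ∂(zeroBias ν)) * x) μ :=
    (hμ2.mul_const _).add (hμ1.const_mul _)
  rw [eμ, integral_add h3 (integrable_const _),
    integral_add (hμ2.mul_const _) (hμ1.const_mul _), integral_mul_const, integral_const_mul,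
    hμ0, integral_const, probReal_univ, one_smul] at h1
  linarith

end Levy

/-! ### The inverse of `h` and Young's inequality. -/

section Inverse

variable {M : EReal} {h H : ℝ → ℝ}

lemma ico_mem_of_le {s t : ℝ} (ht : t ∈ ico M) (hs : 0 ≤ s) (hst : s ≤ t) : s ∈ ico M :=
  ⟨hs, (EReal.coe_le_coe_iff.mpr hst).trans_lt ht.2⟩

lemma exists_gt_mem_ico {t : ℝ} (ht : t ∈ ico M) : ∃ t' ∈ ico M, t < t' := by
  obtain ⟨t', h1, h2⟩ := EReal.lt_iff_exists_real_btwn.mp ht.2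
  have h3 : t < t' := EReal.coe_lt_coe_iff.mp h1
  exact ⟨t', ⟨ht.1.trans h3.le, h2⟩, h3⟩

lemma lt_leftLimit_iff {y : ℝ} :
    (y : EReal) < leftLimit h M ↔ ∃ t ∈ ico M, y < h t := by
  unfold leftLimit
  rw [lt_sSup_iff]
  constructor
  · rintro ⟨_, ⟨t, ht, rfl⟩, hy⟩
    exact ⟨t, ht, EReal.coe_lt_coe_iff.mp hy⟩
  · rintro ⟨t, ht, hy⟩
    exact ⟨_, ⟨t, ht, rfl⟩, EReal.coe_lt_coe_iff.mpr hy⟩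

/-- Since `ico M` has no greatest element, the supremum of a strictly increasing `h` is not
attained, hence the open right end of the image; surjectivity is the intermediate value theorem. -/
lemma bijOn_ico_leftLimit (hM : 0 < M) (h0 : h 0 = 0) (hmono : StrictMonoOn h (ico M))
    (hcont : ContinuousOn h (ico M)) : BijOn h (ico M) (ico (leftLimit h M)) := by
  have hzero : (0 : ℝ) ∈ ico M := ⟨le_rfl, by exact_mod_cast hM⟩
  refine ⟨fun t ht => ⟨?_, ?_⟩, hmono.injOn, fun y hy => ?_⟩
  · rw [← h0]; exact hmono.monotoneOn hzero ht ht.1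
  · obtain ⟨t', ht', hlt⟩ := exists_gt_mem_ico ht
    exact lt_leftLimit_iff.mpr ⟨t', ht', hmono ht ht' hlt⟩
  · obtain ⟨t, ht, hlt⟩ := lt_leftLimit_iff.mp hy.2
    have hsub : Icc 0 t ⊆ ico M := fun s hs => ico_mem_of_le ht hs.1 hs.2
    obtain ⟨s, hs, rfl⟩ := intermediate_value_Icc ht.1 (hcont.mono hsub)
      ⟨by rw [h0]; exact hy.1, hlt.le⟩
    exact ⟨s, hsub hs, rfl⟩

variable (hbij : BijOn h (ico M) (ico (leftLimit h M))) (hmono : StrictMonoOn h (ico M))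

include hbij in
lemma inverseOn_mem {y : ℝ} (hy : y ∈ ico (leftLimit h M)) : inverseOn h M y ∈ ico M :=
  Function.invFunOn_mem (hbij.surjOn hy)

include hbij in
lemma apply_inverseOn {y : ℝ} (hy : y ∈ ico (leftLimit h M)) : h (inverseOn h M y) = y :=
  Function.invFunOn_eq (hbij.surjOn hy)

include hbij hmono in
lemma strictMonoOn_inverseOn : StrictMonoOn (inverseOn h M) (ico (leftLimit h M)) := by
  intro a ha b hb hab
  rw [← hmono.lt_iff_lt (inverseOn_mem hbij ha) (inverseOn_mem hbij hb), apply_inverseOn hbij ha,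
    apply_inverseOn hbij hb]
  exact hab

include hbij hmono in
lemma continuousAt_inverseOn (h0 : h 0 = 0) (hM : 0 < M) {y : ℝ} (hy0 : 0 < y)
    (hy : (y : EReal) < leftLimit h M) : ContinuousAt (inverseOn h M) y := by
  have hzero : (0 : ℝ) ∈ ico M := ⟨le_rfl, by exact_mod_cast hM⟩
  have hym : y ∈ ico (leftLimit h M) := ⟨hy0.le, hy⟩
  have hopen : ∀ L : EReal, IsOpen {s : ℝ | 0 < s ∧ (s : EReal) < L} := fun L =>
    (isOpen_lt continuous_const continuous_id).inter
      (isOpen_lt continuous_coe_real_ereal continuous_const)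
  refine StrictMonoOn.continuousAt_of_image_mem_nhds
    (s := {s : ℝ | 0 < s ∧ (s : EReal) < leftLimit h M})
    ((strictMonoOn_inverseOn hbij hmono).mono fun s hs => ⟨hs.1.le, hs.2⟩)
    ((hopen _).mem_nhds ⟨hy0, hy⟩) ?_
  have hg := inverseOn_mem hbij hym
  have hgpos : 0 < inverseOn h M y := by
    rw [← hmono.lt_iff_lt hzero hg, h0, apply_inverseOn hbij hym]; exact hy0
  refine mem_of_superset ((hopen M).mem_nhds ⟨hgpos, hg.2⟩) ?_
  rintro s ⟨hs0, hsM⟩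
  have hsm : s ∈ ico M := ⟨hs0.le, hsM⟩
  have hhs := hbij.mapsTo hsm
  refine ⟨h s, ⟨?_, hhs.2⟩, ?_⟩
  · rw [← h0]; exact hmono hzero hsm hs0
  · exact hbij.injOn (inverseOn_mem hbij hhs) hsm (apply_inverseOn hbij hhs)

include hbij hmono in
/-- One half of Young's equality for the convex function `H` with derivative `h`. -/
lemma integral_inverseOn_le (h0 : h 0 = 0) (hM : 0 < M) (hH0 : H 0 = 0)
    (hconv : ∀ a ∈ ico M, ∀ b ∈ ico M, h a * (b - a) ≤ H b - H a) {x : ℝ} (hx0 : 0 < x)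
    (hx : (x : EReal) < leftLimit h M) :
    ∫ s in (0 : ℝ)..x, inverseOn h M s ≤ x * inverseOn h M x - H (inverseOn h M x) := by
  set g := inverseOn h M with hg
  set D : ℝ → ℝ := fun y => y * g y - H (g y) with hD
  have hzero : (0 : ℝ) ∈ ico M := ⟨le_rfl, by exact_mod_cast hM⟩
  have hxm : x ∈ ico (leftLimit h M) := ⟨hx0.le, hx⟩
  have hsub : Icc 0 x ⊆ ico (leftLimit h M) := fun s hs => ico_mem_of_le hxm hs.1 hs.2
  have hgm : StrictMonoOn g (ico (leftLimit h M)) := strictMonoOn_inverseOn hbij hmono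
  -- `D` is the Legendre transform of `H`, and `g y` is a subgradient of it at `y`. Exchanging `y`
  -- and `z` traps `D z - D y` between `(z - y) g y` and `(z - y) g z`, whence the Lipschitz bound
  -- and, as `g` is continuous, `D' = g`.
  have hlow : ∀ y ∈ Icc 0 x, ∀ z ∈ Icc 0 x, (z - y) * g y ≤ D z - D y := by
    intro y hy z hz
    have h1 := hconv _ (inverseOn_mem hbij (hsub hz)) _ (inverseOn_mem hbij (hsub hy))
    rw [apply_inverseOn hbij (hsub hz)] at h1
    simp only [hD]
    linarith
  have hg00 : g 0 = 0 := by
    have h0m : (0 : ℝ) ∈ ico (leftLimit h M) := hsub ⟨le_rfl, hx0.le⟩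
    refine hbij.injOn (inverseOn_mem hbij h0m) hzero ?_
    rw [apply_inverseOn hbij h0m, h0]
  have hD0 : D 0 = 0 := by simp [hD, hg00, hH0]
  have hgle : ∀ y ∈ Icc 0 x, 0 ≤ g y ∧ g y ≤ g x := fun y hy =>
    ⟨(inverseOn_mem hbij (hsub hy)).1, hgm.monotoneOn (hsub hy) hxm hy.2⟩
  have hDcont : ContinuousOn D (Icc 0 x) := by
    have : LipschitzOnWith (Real.toNNReal (g x)) D (Icc 0 x) := by
      refine LipschitzOnWith.of_dist_le_mul fun y hy z hz => ?_
      rw [Real.coe_toNNReal _ (hgle x ⟨hx0.le, le_rfl⟩).1, Real.dist_eq, Real.dist_eq]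
      have h1 := hlow y hy z hz
      have h2 := hlow z hz y hy
      have h3 := hgle y hy
      have h4 := hgle z hz
      have h5 := abs_nonneg (y - z)
      have h6 := le_abs_self (y - z)
      have h7 := neg_abs_le (y - z)
      rw [abs_le]
      constructor
      · nlinarith
      · nlinarith
    exact this.continuousOn
  have hderiv : ∀ y ∈ Ioo 0 x, HasDerivAt D (g y) y := by
    intro y hy
    have hyL : (y : EReal) < leftLimit h M := (hsub ⟨hy.1.le, hy.2.le⟩).2
    have hc : ContinuousAt g y := continuousAt_inverseOn hbij hmono h0 hM hy.1 hyL
    rw [hasDerivAt_iff_isLittleO, Asymptotics.isLittleO_iff]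
    intro c hc0
    have h1 : ∀ᶠ z in 𝓝 y, |g z - g y| < c := by
      have := Metric.continuousAt_iff'.mp hc c hc0
      simpa [Real.dist_eq] using this
    filter_upwards [h1, Ioo_mem_nhds hy.1 hy.2] with z hz1 hz2
    have h2 := hlow y (Ioo_subset_Icc_self hy) z (Ioo_subset_Icc_self hz2)
    have h3 := hlow z (Ioo_subset_Icc_self hz2) y (Ioo_subset_Icc_self hy)
    rw [smul_eq_mul, Real.norm_eq_abs, Real.norm_eq_abs, abs_of_nonneg (by linarith)]
    calc D z - D y - (z - y) * g y ≤ (z - y) * (g z - g y) := by linarith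
      _ ≤ |z - y| * |g z - g y| := by rw [← abs_mul]; exact le_abs_self _
      _ ≤ |z - y| * c := by gcongr
      _ = c * |z - y| := mul_comm _ _
  have hint : IntegrableOn g (Icc 0 x) := by
    have : MonotoneOn g (uIcc 0 x) := by
      rw [uIcc_of_le hx0.le]; exact hgm.monotoneOn.mono hsub
    rw [integrableOn_Icc_iff_integrableOn_Ioc,
      ← intervalIntegrable_iff_integrableOn_Ioc_of_le hx0.le]
    exact this.intervalIntegrable
  have := intervalIntegral.integral_le_sub_of_hasDeriv_right_of_le hx0.le hDcont
    (fun y hy => (hderiv y hy).hasDerivWithinAt) hint (fun y _ => le_rfl)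
  rw [hD0, sub_zero] at this
  exact this

end Inverse

/-! ### Comparison inequalities for `expRem`. -/

section ExpRem

lemma hasSum_expRem (y : ℝ) : HasSum (fun n : ℕ => y ^ (n + 2) / ((n + 2).factorial : ℝ))
    (expRem y) := by
  have h := NormedSpace.expSeries_div_hasSum_exp (𝔸 := ℝ) y
  rw [← Real.exp_eq_exp_ℝ] at h
  have h2 := (hasSum_nat_add_iff' 2).mpr h
  have h3 : Real.exp y - ∑ i ∈ Finset.range 2, y ^ i / (i.factorial : ℝ) = expRem y := by
    simp [Finset.sum_range_succ, expRem, sub_sub]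
  rwa [h3] at h2

/-- Monotonicity of `expRem y / y²`, read term by term on the power series. -/
lemma expRem_mul_sq_le {y w : ℝ} (hy : |y| ≤ w) : expRem y * w ^ 2 ≤ y ^ 2 * expRem w := by
  refine hasSum_le (fun n => ?_) ((hasSum_expRem y).mul_right (w ^ 2))
    ((hasSum_expRem w).mul_left (y ^ 2))
  have h1 : y ^ n ≤ w ^ n := by
    calc y ^ n ≤ |y ^ n| := le_abs_self _
      _ = |y| ^ n := abs_pow _ _
      _ ≤ w ^ n := by gcongr
  have h2 : (0 : ℝ) < (n + 2).factorial := by positivity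
  rw [div_mul_eq_mul_div, ← mul_div_assoc]
  apply div_le_div_of_nonneg_right _ h2.le
  calc y ^ (n + 2) * w ^ 2 = y ^ 2 * w ^ 2 * y ^ n := by ring
    _ ≤ y ^ 2 * w ^ 2 * w ^ n := by gcongr
    _ = y ^ 2 * w ^ (n + 2) := by ring

lemma expRem_le_mul_exp_sub_one (y : ℝ) : expRem y ≤ y * (Real.exp y - 1) := by
  have h := Real.add_one_le_exp (-y)
  have h1 : Real.exp (-y) * Real.exp y = 1 := by rw [← Real.exp_add]; simp
  have h2 := Real.exp_pos y
  unfold expRem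
  nlinarith

lemma sq_div_two_le_expRem {y : ℝ} (hy : 0 ≤ y) : y ^ 2 / 2 ≤ expRem y := by
  have := Real.quadratic_le_exp_of_nonneg hy
  unfold expRem; linarith

/-- The tangent line inequality for the convex function `t ↦ expRem (t r)`. -/
lemma mul_le_expRem_sub_expRem (a b r : ℝ) :
    r * (Real.exp (a * r) - 1) * (b - a) ≤ expRem (b * r) - expRem (a * r) := by
  have h := Real.add_one_le_exp (b * r - a * r)
  have h1 : Real.exp (b * r) = Real.exp (a * r) * Real.exp (b * r - a * r) := by
    rw [← Real.exp_add]; congr 1; ring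
  have h2 := Real.exp_pos (a * r)
  unfold expRem
  rw [h1]
  nlinarith

end ExpRem

/-! ### The exponent `W` and its derivative. -/

section WeightedExponent

variable {ν : Measure ℝ} {q : ℝ → ℝ} {M : EReal}

/-- `∫ q(u) |u| (e^{t|u|} - 1) ν(du)`. -/
noncomputable def weightedDeriv (ν : Measure ℝ) (q : ℝ → ℝ) (t : ℝ) : ℝ :=
  ∫ u, q u * (|u| * (Real.exp (t * |u|) - 1)) ∂ν

/-- `∫ q(u) (e^{t|u|} - 1 - t|u|) ν(du)`. -/
noncomputable def weightedExponent (ν : Measure ℝ) (q : ℝ → ℝ) (t : ℝ) : ℝ :=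
  ∫ u, q u * expRem (t * |u|) ∂ν

variable (hq : Continuous q) (hqpos : ∀ u, 0 < q u)
  (hint : ∀ t ∈ ico M, Integrable (fun u => q u * (|u| * (Real.exp (t * |u|) - 1))) ν)

lemma weightedDeriv_zero : weightedDeriv ν q 0 = 0 := by simp [weightedDeriv]

lemma weightedExponent_zero : weightedExponent ν q 0 = 0 := by simp [weightedExponent]

include hqpos hint in
-- The integrand increases strictly at every `u ≠ 0`, and a Lévy measure, nonzero and without atom
-- at the origin, charges those points.
lemma strictMonoOn_weightedDeriv (hν : IsLevyMeasure ν) :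
    StrictMonoOn (weightedDeriv ν q) (ico M) := by
  intro s hs t ht hst
  rw [← sub_pos, weightedDeriv, weightedDeriv, ← integral_sub (hint t ht) (hint s hs)]
  have hpos : ∀ u : ℝ, u ≠ 0 → 0 < q u * (|u| * (Real.exp (t * |u|) - 1)) -
      q u * (|u| * (Real.exp (s * |u|) - 1)) := fun u hu => by
    have h1 : Real.exp (s * |u|) < Real.exp (t * |u|) := by
      apply Real.exp_lt_exp.mpr
      have := abs_pos.mpr hu
      gcongr
    have h2 := mul_pos (mul_pos (hqpos u) (abs_pos.mpr hu)) (sub_pos.mpr h1)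
    nlinarith
  have hi : Integrable (fun u => q u * (|u| * (Real.exp (t * |u|) - 1)) -
      q u * (|u| * (Real.exp (s * |u|) - 1))) ν := (hint t ht).sub (hint s hs)
  rw [integral_pos_iff_support_of_nonneg _ hi]
  · have hsub : ({0}ᶜ : Set ℝ) ⊆ Function.support (fun u => q u * (|u| * (Real.exp (t * |u|) - 1)) -
        q u * (|u| * (Real.exp (s * |u|) - 1))) := fun u hu => (hpos u hu).ne'
    refine lt_of_lt_of_le ?_ (measure_mono hsub)
    rw [pos_iff_ne_zero]
    intro h0
    apply hν.ne_zero
    rw [← Measure.measure_univ_eq_zero, ← union_compl_self ({0} : Set ℝ)]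
    exact measure_union_null hν.zero_atom h0
  · intro u
    rcases eq_or_ne u 0 with rfl | hu
    · simp
    · exact (hpos u hu).le

include hq hqpos hint in
lemma continuousOn_weightedDeriv : ContinuousOn (weightedDeriv ν q) (ico M) := by
  intro t ht
  -- A point to the right of `t` provides the dominating function for all nearby parameters.
  obtain ⟨t', ht', hlt⟩ := exists_gt_mem_ico ht
  refine continuousWithinAt_of_dominated (Eventually.of_forall fun s => by fun_prop) ?_
    (hint t' ht') (Eventually.of_forall fun u => by fun_prop)
  filter_upwards [self_mem_nhdsWithin, mem_nhdsWithin_of_mem_nhds (Iio_mem_nhds hlt)] with s hs hs'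
  refine Eventually.of_forall fun u => ?_
  have h1 : 1 ≤ Real.exp (s * |u|) := Real.one_le_exp (mul_nonneg hs.1 (abs_nonneg u))
  have h2 : 0 ≤ Real.exp (s * |u|) - 1 := by linarith
  have h3 := (hqpos u).le
  have h4 : s ≤ t' := le_of_lt hs'
  rw [Real.norm_eq_abs, abs_of_nonneg (by positivity)]
  gcongr

include hq hqpos hint in
lemma integrable_weightedExponent {t : ℝ} (ht : t ∈ ico M) :
    Integrable (fun u => q u * expRem (t * |u|)) ν := by
  refine ((hint t ht).const_mul t).mono' (by fun_prop) (Eventually.of_forall fun u => ?_)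
  have h3 := (hqpos u).le
  rw [Real.norm_eq_abs, abs_of_nonneg (mul_nonneg h3 (expRem_nonneg _))]
  calc q u * expRem (t * |u|) ≤ q u * (t * |u| * (Real.exp (t * |u|) - 1)) := by
        gcongr; exact expRem_le_mul_exp_sub_one _
    _ = t * (q u * (|u| * (Real.exp (t * |u|) - 1))) := by ring

include hq hqpos hint in
lemma weightedDeriv_mul_le {a b : ℝ} (ha : a ∈ ico M) (hb : b ∈ ico M) :
    weightedDeriv ν q a * (b - a) ≤ weightedExponent ν q b - weightedExponent ν q a := by
  have hib := integrable_weightedExponent hq hqpos hint hb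
  have hia := integrable_weightedExponent hq hqpos hint ha
  rw [weightedDeriv, weightedExponent, weightedExponent, ← integral_sub hib hia,
    ← integral_mul_const]
  refine integral_mono ((hint a ha).mul_const _) (hib.sub hia) fun u => ?_
  have h1 := mul_le_mul_of_nonneg_left (mul_le_expRem_sub_expRem a b |u|) (hqpos u).le
  simp only
  nlinarith

include hq hqpos hint in
lemma sq_mul_le_weightedExponent {t : ℝ} (ht : t ∈ ico M)
    (hq2 : Integrable (fun u => q u * u ^ 2) ν) :
    (∫ u, q u * u ^ 2 ∂ν) * t ^ 2 / 2 ≤ weightedExponent ν q t := by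
  rw [mul_div_assoc, ← integral_mul_const, weightedExponent]
  refine integral_mono (hq2.mul_const _) (integrable_weightedExponent hq hqpos hint ht) fun u => ?_
  have h1 := sq_div_two_le_expRem (mul_nonneg ht.1 (abs_nonneg u))
  have h2 := mul_le_mul_of_nonneg_left h1 (hqpos u).le
  simp only
  rw [mul_pow, sq_abs] at h2
  linarith

end WeightedExponent

/-! ### Increments of the truncated norm of a projection. -/

section Norm

variable {V : Type*} [NormedAddCommGroup V] [InnerProductSpace ℝ V]

/-- With `B = max ‖y‖ c`, the upper bound comes from `‖y + z‖² ≤ B² + 2W ≤ (B + W/B)²`. The lower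
one is Cauchy–Schwarz for `⟨y + z, y⟩` when `‖y‖ ≥ c`, and trivial otherwise because `c` is then the
minimum. -/
lemma abs_max_norm_add_sub_le (y z : V) {c : ℝ} (hc : 0 < c) :
    |max ‖y + z‖ c - max ‖y‖ c| ≤ (|inner ℝ y z| + ‖z‖ ^ 2 / 2) / max ‖y‖ c := by
  set B := max ‖y‖ c with hB
  have hBpos : 0 < B := lt_of_lt_of_le hc (le_max_right _ _)
  set W := |inner ℝ y z| + ‖z‖ ^ 2 / 2 with hW
  have hW0 : 0 ≤ W := by positivity
  have hWB : 0 ≤ W / B := by positivity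
  have hyB : ‖y‖ ≤ B := le_max_left _ _
  have hsq := norm_add_sq_real y z
  rw [abs_le]
  constructor
  · rcases le_total ‖y‖ c with h | h
    · have h1 : B = c := max_eq_right h
      have h2 : c ≤ max ‖y + z‖ c := le_max_right _ _
      linarith
    · have h1 : B = ‖y‖ := max_eq_left h
      have h2 : inner ℝ (y + z) y ≤ ‖y + z‖ * ‖y‖ := real_inner_le_norm _ _
      rw [inner_add_left, real_inner_self_eq_norm_sq, real_inner_comm, ← h1] at h2
      have h3 := neg_abs_le (inner ℝ y z)
      have h4 : B - W / B ≤ ‖y + z‖ := by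
        rw [sub_le_iff_le_add, ← sub_le_iff_le_add', le_div_iff₀ hBpos]
        nlinarith [sq_nonneg ‖z‖]
      have h5 : ‖y + z‖ ≤ max ‖y + z‖ c := le_max_left _ _
      linarith
  · have h1 : ‖y + z‖ ≤ B + W / B := by
      apply le_of_sq_le_sq _ (by positivity)
      have h2 : (B + W / B) ^ 2 = B ^ 2 + 2 * W + (W / B) ^ 2 := by
        field_simp; ring
      have h3 := le_abs_self (inner ℝ y z)
      have h4 : ‖y‖ ^ 2 ≤ B ^ 2 := by gcongr
      rw [h2, hsq, hW]
      nlinarith [sq_nonneg (W / B)]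
    have h5 : c ≤ B := le_max_right _ _
    have h6 : max ‖y + z‖ c ≤ B + W / B := max_le h1 (by linarith)
    linarith

end Norm

section Projection

variable {d : ℕ} (S : Submodule ℝ (EuclideanSpace ℝ (Fin d)))

/-- The squared Hilbert–Schmidt norm of the projection, that is, the dimension of `S`. -/
noncomputable def projTrace : ℝ := ∑ k, ‖S.starProjection (EuclideanSpace.single k (1 : ℝ))‖ ^ 2

lemma starProjection_add_single (x : EuclideanSpace ℝ (Fin d)) (k : Fin d) (u : ℝ) :
    S.starProjection (x + EuclideanSpace.single k u) =
      S.starProjection x + u • S.starProjection (EuclideanSpace.single k (1 : ℝ)) := by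
  rw [map_add, ← map_smul]
  congr 2
  ext i
  simp

lemma norm_starProjection_single_le (k : Fin d) :
    ‖S.starProjection (EuclideanSpace.single k (1 : ℝ))‖ ≤ 1 := by
  refine (S.norm_starProjection_apply_le _).trans ?_
  simp

/-- The projection is self-adjoint and idempotent. -/
lemma inner_starProjection_single (x : EuclideanSpace ℝ (Fin d)) (k : Fin d) :
    inner ℝ (S.starProjection x) (S.starProjection (EuclideanSpace.single k (1 : ℝ))) =
      S.starProjection x k := by
  rw [← Submodule.inner_starProjection_left_eq_right,
    Submodule.starProjection_eq_self_iff.mpr (Submodule.starProjection_apply_mem S x)]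
  simp [EuclideanSpace.inner_single_right]

/-- The norm of the projection, truncated from below. -/
noncomputable def truncNorm (c : ℝ) (x : EuclideanSpace ℝ (Fin d)) : ℝ :=
  max ‖S.starProjection x‖ c

lemma continuous_truncNorm (c : ℝ) : Continuous (truncNorm S c) := by
  unfold truncNorm; fun_prop

lemma abs_truncNorm_add_single_sub_le (c : ℝ) (x : EuclideanSpace ℝ (Fin d)) (k : Fin d) (u : ℝ) :
    |truncNorm S c (x + EuclideanSpace.single k u) - truncNorm S c x| ≤ |u| := by
  unfold truncNorm
  refine (abs_max_sub_max_le_abs _ _ _).trans ?_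
  refine (abs_norm_sub_norm_le _ _).trans ?_
  rw [starProjection_add_single, add_sub_cancel_left, norm_smul, Real.norm_eq_abs]
  have := norm_starProjection_single_le S k
  nlinarith [abs_nonneg u]

/-- With `y = Πx`, `(a + b)² ≤ 2a² + 2b²` splits each increment into a part in `⟨y, Πe_k⟩ = y_k`,
whose squares sum to `‖y‖² ≤ B²`, and a second order part, whose squares sum to at most a multiple
of the trace. The trace is at most `K B²/2` because `B ≥ c`: here the dimension disappears. -/
lemma sum_sq_truncNorm_sub_le {c K : ℝ} (hc : 0 < c) (hK : 2 * projTrace S ≤ K * c ^ 2)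
    (x : EuclideanSpace ℝ (Fin d)) (u : ℝ) :
    ∑ k, (truncNorm S c (x + EuclideanSpace.single k u) - truncNorm S c x) ^ 2 ≤
      u ^ 2 * (8 + K * u ^ 2) / 4 := by
  set y := S.starProjection x with hy
  set B := truncNorm S c x with hB
  have hcB : c ≤ B := le_max_right _ _
  have hBpos : 0 < B := hc.trans_le hcB
  have hyB : ‖y‖ ≤ B := le_max_left _ _
  set p : Fin d → ℝ := fun k => ‖S.starProjection (EuclideanSpace.single k (1 : ℝ))‖ ^ 2 with hp
  have hp0 : ∀ k, 0 ≤ p k := fun k => sq_nonneg _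
  have hp1 : ∀ k, p k ≤ 1 := fun k =>
    pow_le_one₀ (norm_nonneg _) (norm_starProjection_single_le S k)
  have hterm : ∀ k, (truncNorm S c (x + EuclideanSpace.single k u) - B) ^ 2 ≤
      (2 * u ^ 2 * (y k) ^ 2 + u ^ 4 / 2 * p k) / B ^ 2 := by
    intro k
    have h1 := abs_max_norm_add_sub_le y
      (u • S.starProjection (EuclideanSpace.single k (1 : ℝ))) hc
    rw [hy, ← starProjection_add_single, inner_smul_right, inner_starProjection_single,
      norm_smul, mul_pow, Real.norm_eq_abs, sq_abs, ← hy] at h1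
    change |truncNorm S c (x + EuclideanSpace.single k u) - B| ≤
      (|u * y k| + u ^ 2 * p k / 2) / B at h1
    rw [← sq_abs]
    calc |truncNorm S c (x + EuclideanSpace.single k u) - B| ^ 2
        ≤ ((|u * y k| + u ^ 2 * p k / 2) / B) ^ 2 := by gcongr
      _ = (|u * y k| + u ^ 2 * p k / 2) ^ 2 / B ^ 2 := div_pow _ _ _
      _ ≤ (2 * u ^ 2 * (y k) ^ 2 + u ^ 4 / 2 * p k) / B ^ 2 := by
        gcongr
        have h2 : |u * y k| ^ 2 = u ^ 2 * (y k) ^ 2 := by rw [sq_abs, mul_pow]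
        have h3 : p k ^ 2 ≤ p k := by nlinarith [hp0 k, hp1 k]
        have h4 : u ^ 4 * p k ^ 2 ≤ u ^ 4 * p k := by gcongr
        nlinarith [sq_nonneg (|u * y k| - u ^ 2 * p k / 2)]
  have hysum : ∑ k, (y k) ^ 2 = ‖y‖ ^ 2 := by
    rw [EuclideanSpace.norm_sq_eq]; simp
  have hpsum : ∑ k, p k = projTrace S := rfl
  calc ∑ k, (truncNorm S c (x + EuclideanSpace.single k u) - B) ^ 2
      ≤ ∑ k, (2 * u ^ 2 * (y k) ^ 2 + u ^ 4 / 2 * p k) / B ^ 2 := Finset.sum_le_sum fun k _ => hterm k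
    _ = (2 * u ^ 2 * ‖y‖ ^ 2 + u ^ 4 / 2 * projTrace S) / B ^ 2 := by
      rw [← Finset.sum_div, Finset.sum_add_distrib, ← Finset.mul_sum, ← Finset.mul_sum, hysum, hpsum]
    _ ≤ u ^ 2 * (8 + K * u ^ 2) / 4 := by
      rw [div_le_iff₀ (by positivity)]
      have h1 : ‖y‖ ^ 2 ≤ B ^ 2 := by gcongr
      have h2 : c ^ 2 ≤ B ^ 2 := by gcongr
      have hT : 0 ≤ projTrace S := Finset.sum_nonneg fun k _ => hp0 k
      have hK0 : 0 ≤ K := by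
        by_contra hneg
        push Not at hneg
        have : 0 < c ^ 2 := by positivity
        nlinarith
      have h3 : 2 * projTrace S ≤ K * B ^ 2 := hK.trans (by gcongr)
      have h4 : u ^ 2 * ‖y‖ ^ 2 ≤ u ^ 2 * B ^ 2 := by gcongr
      have h5 : u ^ 4 * (2 * projTrace S) ≤ u ^ 4 * (K * B ^ 2) := by gcongr
      nlinarith

end Projection

/-! ### Chernoff bounds for functions with controlled increments along the axes. -/

section Tails

variable {d : ℕ} {ν : Measure ℝ} {q : ℝ → ℝ} {M : EReal}
  (hq : Continuous q) (hqpos : ∀ u, 0 < q u)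
  (hint : ∀ t ∈ ico M, Integrable (fun u => q u * (|u| * (Real.exp (t * |u|) - 1))) ν)

lemma measurable_single (k : Fin d) :
    Measurable fun u : ℝ => (EuclideanSpace.single k u : EuclideanSpace ℝ (Fin d)) := by
  have : Continuous fun u : ℝ => (EuclideanSpace.single k u : EuclideanSpace ℝ (Fin d)) :=
    (Isometry.of_dist_eq fun a b => PiLp.dist_single_same 2 (fun _ => ℝ) k a b).continuous
  exact this.measurable

include hq hqpos hint in
-- Each increment is at most `t|u|`, so `expRem_mul_sq_le` bounds its remainder by its square times
-- `expRem (t|u|)/(t|u|)²`; the quadratic bound `h2` then controls the sum over all axes at once.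
lemma jumpBound_axisMeasure {t : ℝ} (ht : t ∈ ico M) (ht0 : 0 < t)
    {f : EuclideanSpace ℝ (Fin d) → ℝ} (hf : Measurable f)
    (h1 : ∀ x k u, |f (x + EuclideanSpace.single k u) - f x| ≤ t * |u|)
    (h2 : ∀ x u, ∑ k, (f (x + EuclideanSpace.single k u) - f x) ^ 2 ≤
      t ^ 2 * (u ^ 2 * q u / 4)) :
    JumpBound (axisMeasure d ν) (weightedExponent ν q t / 4) f := by
  intro x
  have hsm := measurable_single (d := d)
  have hRm := continuous_expRem.measurable
  have hpt : ∀ u, ∑ k, expRem (f (x + EuclideanSpace.single k u) - f x) ≤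
      q u * expRem (t * |u|) / 4 := by
    intro u
    rcases eq_or_ne u 0 with rfl | hu
    · have : ∀ k : Fin d, expRem (f (x + EuclideanSpace.single k 0) - f x) = 0 := fun k => by
        have := h1 x k 0
        rw [abs_zero, mul_zero] at this
        rw [abs_nonpos_iff.mp this, expRem_zero]
      simp [this]
    · have hw : 0 < (t * |u|) ^ 2 := by have := abs_pos.mpr hu; positivity
      refine le_of_mul_le_mul_right ?_ hw
      rw [Finset.sum_mul]
      calc ∑ k, expRem (f (x + EuclideanSpace.single k u) - f x) * (t * |u|) ^ 2
          ≤ ∑ k, (f (x + EuclideanSpace.single k u) - f x) ^ 2 * expRem (t * |u|) :=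
            Finset.sum_le_sum fun k _ => expRem_mul_sq_le (h1 x k u)
        _ = (∑ k, (f (x + EuclideanSpace.single k u) - f x) ^ 2) * expRem (t * |u|) := by
            rw [Finset.sum_mul]
        _ ≤ t ^ 2 * (u ^ 2 * q u / 4) * expRem (t * |u|) := by
            gcongr
            · exact expRem_nonneg _
            · exact h2 x u
        _ = q u * expRem (t * |u|) / 4 * (t * |u|) ^ 2 := by rw [mul_pow, sq_abs]; ring
  rw [axisMeasure, lintegral_finsetSum_measure]
  calc ∑ k, ∫⁻ u, ENNReal.ofReal (expRem (f (x + u) - f x))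
          ∂(ν.map fun u : ℝ => EuclideanSpace.single k u)
      = ∑ k, ∫⁻ u, ENNReal.ofReal (expRem (f (x + EuclideanSpace.single k u) - f x)) ∂ν := by
        refine Finset.sum_congr rfl fun k _ => ?_
        rw [lintegral_map (by fun_prop) (hsm k)]
    _ = ∫⁻ u, ∑ k, ENNReal.ofReal (expRem (f (x + EuclideanSpace.single k u) - f x)) ∂ν := by
        rw [lintegral_finsetSum]
        intro k _
        have := hsm k
        fun_prop
    _ ≤ ∫⁻ u, ENNReal.ofReal (q u * expRem (t * |u|) / 4) ∂ν := by
        refine lintegral_mono fun u => ?_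
        rw [← ENNReal.ofReal_sum_of_nonneg fun k _ => expRem_nonneg _]
        exact ENNReal.ofReal_le_ofReal (hpt u)
    _ = ENNReal.ofReal (weightedExponent ν q t / 4) := by
        rw [← ofReal_integral_eq_lintegral_ofReal
          ((integrable_weightedExponent hq hqpos hint ht).div_const 4), integral_div]
        · rfl
        · refine Eventually.of_forall fun u => ?_
          have := expRem_nonneg (t * |u|)
          have := hqpos u
          positivity

variable {μ : Measure (EuclideanSpace ℝ (Fin d))} [IsProbabilityMeasure μ]
  {γ : EuclideanSpace ℝ (Fin d)} (hID : IsID μ γ (axisMeasure d ν))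
  {F : EuclideanSpace ℝ (Fin d) → ℝ} (hFc : Continuous F) (hF0 : ∀ x, 0 ≤ F x)
  (hFi : Integrable F μ)
  (hF1 : ∀ x k u, |F (x + EuclideanSpace.single k u) - F x| ≤ |u|)
  (hF2 : ∀ x u, ∑ k, (F (x + EuclideanSpace.single k u) - F x) ^ 2 ≤ u ^ 2 * q u / 4)

include hqpos in
lemma weightedExponent_nonneg (t : ℝ) : 0 ≤ weightedExponent ν q t :=
  integral_nonneg fun u => mul_nonneg (hqpos u).le (expRem_nonneg _)

include hq hqpos hint hID hFc hF0 hF1 hF2 in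
-- Truncation at `R` makes the function bounded without enlarging its increments; `s = ±t` covers
-- both tails.
lemma integral_exp_min_le {t : ℝ} (ht : t ∈ ico M) (ht0 : 0 < t) {s : ℝ} (hs : |s| = t)
    {R : ℝ} (hR : 0 ≤ R) : ∫ x, Real.exp (s * min (F x) R) ∂μ ≤
      Real.exp (s * ∫ x, min (F x) R ∂μ + weightedExponent ν q t / 4) := by
  rw [← integral_const_mul]
  have hmin : ∀ a b : ℝ, |min a R - min b R| ≤ |a - b| := fun a b => by
    simpa using abs_min_sub_min_le_max a R b R
  have hdiff : ∀ x k u, |s * min (F (x + EuclideanSpace.single k u)) R - s * min (F x) R| ≤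
      t * |F (x + EuclideanSpace.single k u) - F x| := fun x k u => by
    rw [← mul_sub, abs_mul, hs]
    exact mul_le_mul_of_nonneg_left (hmin _ _) ht0.le
  refine integral_exp_le_of_isID hID (f := fun x => s * min (F x) R) (by fun_prop)
    (B := t * R) (fun x => ?_) (div_nonneg (weightedExponent_nonneg hqpos t) (by norm_num))
    (jumpBound_axisMeasure hq hqpos hint ht ht0 (by fun_prop) ?_ ?_)
  · rw [abs_mul, hs, abs_of_nonneg (le_min (hF0 x) hR)]
    gcongr
    exact min_le_right _ _
  · intro x k u
    refine (hdiff x k u).trans ?_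
    exact mul_le_mul_of_nonneg_left (hF1 x k u) ht0.le
  · intro x u
    refine le_trans ?_ (mul_le_mul_of_nonneg_left (hF2 x u) (sq_nonneg t))
    rw [Finset.mul_sum]
    refine Finset.sum_le_sum fun k _ => ?_
    rw [← mul_pow, ← sq_abs, ← sq_abs (t * _), abs_mul t, abs_of_pos ht0]
    gcongr
    exact hdiff x k u

include hFc in
lemma integrable_exp_mul_min {s R : ℝ} (hR : 0 ≤ R) (hF0 : ∀ x, 0 ≤ F x) :
    Integrable (fun x => Real.exp (s * min (F x) R)) μ := by
  refine integrable_exp_of_abs_le (B := |s| * R) (by fun_prop) fun x => ?_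
  rw [abs_mul, abs_of_nonneg (le_min (hF0 x) hR)]
  gcongr
  exact min_le_right _ _

include hq hqpos hint hID hFc hF0 hF1 hF2 hFi in
/-- Upper deviations. -/
lemma measure_ge_le_exp {t : ℝ} (ht : t ∈ ico M) (ht0 : 0 < t) (y : ℝ) :
    μ.real {x | y ≤ F x} ≤
      Real.exp (-t * (y - ∫ x, F x ∂μ) + weightedExponent ν q t / 4) := by
  -- Truncating at `R ≥ y` leaves the event unchanged and only lowers the mean.
  set R := max y 0 with hR
  have hR0 : 0 ≤ R := le_max_right _ _
  have hset : {x | y ≤ F x} = {x | y ≤ min (F x) R} := by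
    ext x
    simp only [mem_ofPred_eq]
    exact ⟨fun h => le_min h (le_max_left _ _), fun h => h.trans (min_le_left _ _)⟩
  have h1 := measure_ge_le_exp_mul_mgf (X := fun x => min (F x) R) (μ := μ) y ht0.le
    (integrable_exp_mul_min hFc hR0 hF0)
  have h2 := integral_exp_min_le hq hqpos hint hID hFc hF0 hF1 hF2 ht ht0 (abs_of_pos ht0) hR0
  have h3 : ∫ x, min (F x) R ∂μ ≤ ∫ x, F x ∂μ := by
    refine integral_mono_of_nonneg (Eventually.of_forall fun x => le_min (hF0 x) hR0) hFi
      (Eventually.of_forall fun x => min_le_left _ _)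
  rw [hset]
  refine h1.trans ?_
  rw [mgf]
  calc Real.exp (-t * y) * ∫ x, Real.exp (t * min (F x) R) ∂μ
      ≤ Real.exp (-t * y) * Real.exp (t * ∫ x, F x ∂μ + weightedExponent ν q t / 4) := by
        gcongr
        refine h2.trans ?_
        gcongr
    _ = _ := by rw [← Real.exp_add]; congr 1; ring

include hq hqpos hint hID hFc hF0 hF1 hF2 hFi in
/-- Lower deviations. -/
lemma measure_le_le_exp {t : ℝ} (ht : t ∈ ico M) (ht0 : 0 < t) (y : ℝ) :
    μ.real {x | F x ≤ y} ≤
      Real.exp (-t * (∫ x, F x ∂μ - y) + weightedExponent ν q t / 4) := by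
  -- Here truncation lowers the mean in the unfavourable direction, so the level is sent to
  -- infinity.
  have hlim : Tendsto (fun n : ℕ => ∫ x, min (F x) n ∂μ) atTop (𝓝 (∫ x, F x ∂μ)) := by
    refine tendsto_integral_of_dominated_convergence F (fun n => by fun_prop) hFi
      (fun n => Eventually.of_forall fun x => ?_) (Eventually.of_forall fun x => ?_)
    · rw [Real.norm_eq_abs, abs_of_nonneg (le_min (hF0 x) n.cast_nonneg)]
      exact min_le_left _ _
    · refine tendsto_const_nhds.congr' ?_
      filter_upwards [tendsto_natCast_atTop_atTop.eventually_ge_atTop (F x)] with n hn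
      exact (min_eq_left hn).symm
  have hb : ∀ n : ℕ, μ.real {x | F x ≤ y} ≤
      Real.exp (-t * (∫ x, min (F x) n ∂μ - y) + weightedExponent ν q t / 4) := by
    intro n
    have hR0 : (0 : ℝ) ≤ n := n.cast_nonneg
    have h1 := measure_le_le_exp_mul_mgf (X := fun x => min (F x) n) (μ := μ) (t := -t) y
      (by linarith) (integrable_exp_mul_min hFc hR0 hF0)
    have h2 := integral_exp_min_le hq hqpos hint hID hFc hF0 hF1 hF2 ht ht0
      (s := -t) (by rw [abs_neg, abs_of_pos ht0]) hR0
    have h4 : μ.real {x | F x ≤ y} ≤ μ.real {x | min (F x) n ≤ y} :=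
      measureReal_mono fun x (hx : F x ≤ y) =>
        show min (F x) n ≤ y from (min_le_left _ _).trans hx
    refine (h4.trans h1).trans ?_
    rw [mgf]
    calc Real.exp (- -t * y) * ∫ x, Real.exp (-t * min (F x) n) ∂μ
        ≤ Real.exp (- -t * y) *
          Real.exp (-t * ∫ x, min (F x) n ∂μ + weightedExponent ν q t / 4) := by gcongr
      _ = _ := by rw [← Real.exp_add]; congr 1; ring
  refine ge_of_tendsto' ((Real.continuous_exp.tendsto _).comp
    (((hlim.sub_const y).const_mul (-t)).add_const _)) hb

end Tails

/-! ### Second moments of quadratic forms in independent variables. -/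

section FourthMoment

variable {Ω ι : Type*} [MeasurableSpace Ω] [Fintype ι] [DecidableEq ι] {P : Measure Ω}
  [IsProbabilityMeasure P] {ξ : ι → Ω → ℝ} {s κ : ℝ}

lemma integrable_prod_four {a b c e : Ω → ℝ} (hma : Measurable a) (hmb : Measurable b)
    (hmc : Measurable c) (hme : Measurable e) (ha : Integrable (fun ω => a ω ^ 4) P)
    (hb : Integrable (fun ω => b ω ^ 4) P) (hc : Integrable (fun ω => c ω ^ 4) P)
    (he : Integrable (fun ω => e ω ^ 4) P) :
    Integrable (fun ω => a ω * b ω * (c ω * e ω)) P := by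
  refine (((ha.add hb).add hc).add he).mono' (by fun_prop) (Eventually.of_forall fun ω => ?_)
  simp only [Pi.add_apply, Real.norm_eq_abs]
  rw [abs_le]
  have h1 := sq_nonneg (a ω * b ω - c ω * e ω)
  have h2 := sq_nonneg (a ω * b ω + c ω * e ω)
  have h3 := sq_nonneg (a ω ^ 2 - b ω ^ 2)
  have h4 := sq_nonneg (c ω ^ 2 - e ω ^ 2)
  have h5 := sq_nonneg (a ω ^ 2 + b ω ^ 2)
  have h6 := sq_nonneg (c ω ^ 2 + e ω ^ 2)
  constructor <;> nlinarith

lemma integrable_pow_of_pow_four {a : Ω → ℝ} (hma : Measurable a)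
    (ha : Integrable (fun ω => a ω ^ 4) P) : Integrable a P ∧ Integrable (fun ω => a ω ^ 2) P := by
  constructor
  · refine (ha.add (integrable_const (1 : ℝ))).mono' (by fun_prop) (Eventually.of_forall fun ω => ?_)
    simp only [Pi.add_apply, Real.norm_eq_abs]
    rw [abs_le]
    constructor <;> nlinarith [sq_nonneg (a ω ^ 2 - 1 / 2), sq_nonneg (a ω - 1 / 2),
      sq_nonneg (a ω + 1 / 2)]
  · refine (ha.add (integrable_const (1 : ℝ))).mono' (by fun_prop) (Eventually.of_forall fun ω => ?_)
    simp only [Pi.add_apply, Real.norm_eq_abs]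
    rw [abs_le]
    constructor <;> nlinarith [sq_nonneg (a ω ^ 2 - 1), sq_nonneg (a ω)]

variable (hξ : ∀ i, Measurable (ξ i)) (hind : iIndepFun ξ P)

include hξ hind in
-- A factor whose index differs from the three others is independent of their product and centered.
lemma integral_prod_four_of_ne (h0 : ∀ i, ∫ ω, ξ i ω ∂P = 0) {i j k l : ι} (hj : i ≠ j)
    (hk : i ≠ k) (hl : i ≠ l) : ∫ ω, ξ i ω * (ξ j ω * ξ k ω * ξ l ω) ∂P = 0 := by
  have h := hind.indepFun_finset {i} {j, k, l} (by simp [hj, hk, hl]) hξ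
  have hpi : ∀ a : ({j, k, l} : Finset ι),
      Measurable fun v : ({j, k, l} : Finset ι) → ℝ => v a := fun a => measurable_pi_apply a
  have hpi' : ∀ a : ({i} : Finset ι), Measurable fun v : ({i} : Finset ι) → ℝ => v a :=
    fun a => measurable_pi_apply a
  have h2 := h.comp (φ := fun v : ({i} : Finset ι) → ℝ => v ⟨i, by simp⟩)
    (ψ := fun v : ({j, k, l} : Finset ι) → ℝ =>
      v ⟨j, by simp⟩ * v ⟨k, by simp⟩ * v ⟨l, by simp⟩) (hpi' ⟨i, by simp⟩)
    (((hpi ⟨j, by simp⟩).mul (hpi ⟨k, by simp⟩)).mul (hpi ⟨l, by simp⟩))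
  have h3 := h2.integral_fun_mul_eq_mul_integral
    (by apply Measurable.aestronglyMeasurable; have := hξ i; simpa [Function.comp_def] using this)
    (by
      apply Measurable.aestronglyMeasurable
      have hj' := hξ j
      have hk' := hξ k
      have hl' := hξ l
      simp only [Function.comp_def]
      fun_prop)
  simp only [Function.comp_def] at h3
  rw [h3, h0, zero_mul]

include hξ hind in
lemma integral_sq_mul_sq (h2 : ∀ i, ∫ ω, ξ i ω ^ 2 ∂P = s) {i j : ι} (hij : i ≠ j) :
    ∫ ω, ξ i ω ^ 2 * ξ j ω ^ 2 ∂P = s ^ 2 := by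
  have h := (hind.indepFun hij).comp (φ := fun x => x ^ 2) (ψ := fun x => x ^ 2)
    (by fun_prop) (by fun_prop)
  have h3 := h.integral_fun_mul_eq_mul_integral
    (by apply Measurable.aestronglyMeasurable; have := hξ i; simp only [Function.comp_def]; fun_prop)
    (by apply Measurable.aestronglyMeasurable; have := hξ j; simp only [Function.comp_def]; fun_prop)
  simp only [Function.comp_def] at h3
  rw [h3, h2, h2]; ring

include hξ hind in
/-- Mixed fourth moments of independent centered variables. -/
lemma integral_prod_four (h0 : ∀ i, ∫ ω, ξ i ω ∂P = 0) (h2 : ∀ i, ∫ ω, ξ i ω ^ 2 ∂P = s)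
    (h4 : ∀ i, ∫ ω, ξ i ω ^ 4 ∂P = 3 * s ^ 2 + κ) (i j k l : ι) :
    ∫ ω, ξ i ω * ξ j ω * (ξ k ω * ξ l ω) ∂P =
      κ * (if i = j ∧ i = k ∧ i = l then 1 else 0) +
      s ^ 2 * ((if i = j ∧ k = l then 1 else 0) + (if i = k ∧ j = l then 1 else 0) +
        (if i = l ∧ j = k then 1 else 0)) := by
  have hne := fun {i j k l : ι} => integral_prod_four_of_ne (i := i) (j := j) (k := k) (l := l)
    hξ hind h0
  have hsq := fun {i j : ι} => integral_sq_mul_sq (i := i) (j := j) hξ hind h2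
  by_cases hij : i = j
  · subst hij
    by_cases hkl : k = l
    · subst hkl
      by_cases hik : i = k
      · subst hik
        have : ∀ ω, ξ i ω * ξ i ω * (ξ i ω * ξ i ω) = ξ i ω ^ 4 := fun ω => by ring
        simp_rw [this]
        rw [h4]; simp; ring
      · have : ∀ ω, ξ i ω * ξ i ω * (ξ k ω * ξ k ω) = ξ i ω ^ 2 * ξ k ω ^ 2 := fun ω => by ring
        simp_rw [this]
        rw [hsq hik]; simp [hik]
    · by_cases hik : i = k
      · subst hik
        have : ∀ ω, ξ i ω * ξ i ω * (ξ i ω * ξ l ω) = ξ l ω * (ξ i ω * ξ i ω * ξ i ω) :=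
          fun ω => by ring
        simp_rw [this]
        rw [hne (Ne.symm hkl) (Ne.symm hkl) (Ne.symm hkl)]; simp [hkl]
      · have : ∀ ω, ξ i ω * ξ i ω * (ξ k ω * ξ l ω) = ξ k ω * (ξ i ω * ξ i ω * ξ l ω) :=
          fun ω => by ring
        simp_rw [this]
        rw [hne (Ne.symm hik) (Ne.symm hik) hkl]; simp [hkl, hik]
  · by_cases hik : i = k
    · subst hik
      by_cases hjl : j = l
      · subst hjl
        have : ∀ ω, ξ i ω * ξ j ω * (ξ i ω * ξ j ω) = ξ i ω ^ 2 * ξ j ω ^ 2 := fun ω => by ring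
        simp_rw [this]
        rw [hsq hij]; simp [hij]
      · have : ∀ ω, ξ i ω * ξ j ω * (ξ i ω * ξ l ω) = ξ j ω * (ξ i ω * ξ i ω * ξ l ω) :=
          fun ω => by ring
        simp_rw [this]
        rw [hne (Ne.symm hij) (Ne.symm hij) hjl]; simp [hij, hjl, Ne.symm hij]
    · by_cases hil : i = l
      · subst hil
        by_cases hjk : j = k
        · subst hjk
          have : ∀ ω, ξ i ω * ξ j ω * (ξ j ω * ξ i ω) = ξ i ω ^ 2 * ξ j ω ^ 2 := fun ω => by ring
          simp_rw [this]
          rw [hsq hij]; simp [hij]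
        · have : ∀ ω, ξ i ω * ξ j ω * (ξ k ω * ξ i ω) = ξ j ω * (ξ i ω * ξ i ω * ξ k ω) :=
            fun ω => by ring
          simp_rw [this]
          rw [hne (Ne.symm hij) (Ne.symm hij) hjk]; simp [hij, hjk, hik]
      · have : ∀ ω, ξ i ω * ξ j ω * (ξ k ω * ξ l ω) = ξ i ω * (ξ j ω * ξ k ω * ξ l ω) :=
          fun ω => by ring
        simp_rw [this]
        rw [hne hij hik hil]; simp [hij, hik, hil]

include hξ hind in
/-- Variance of a quadratic form in independent variables. -/
lemma integral_quadratic_form (h0 : ∀ i, ∫ ω, ξ i ω ∂P = 0) (h2 : ∀ i, ∫ ω, ξ i ω ^ 2 ∂P = s)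
    (hi4 : ∀ i, Integrable (fun ω => ξ i ω ^ 4) P)
    (h4 : ∀ i, ∫ ω, ξ i ω ^ 4 ∂P = 3 * s ^ 2 + κ) (a : ι → ι → ℝ) (ha : ∀ i j, a i j = a j i) :
    ∫ ω, ∑ i, ∑ j, a i j * (ξ i ω * ξ j ω) ∂P = s * ∑ i, a i i ∧
    Integrable (fun ω => (∑ i, ∑ j, a i j * (ξ i ω * ξ j ω)) ^ 2) P ∧
    ∫ ω, (∑ i, ∑ j, a i j * (ξ i ω * ξ j ω)) ^ 2 ∂P =
      κ * ∑ i, a i i ^ 2 + s ^ 2 * ((∑ i, a i i) ^ 2 + 2 * ∑ i, ∑ j, a i j ^ 2) := by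
  have hi2 : ∀ i j, Integrable (fun ω => ξ i ω * ξ j ω) P := fun i j => by
    have hi := (integrable_pow_of_pow_four (hξ i) (hi4 i)).2
    have hj := (integrable_pow_of_pow_four (hξ j) (hi4 j)).2
    have hmi := hξ i
    have hmj := hξ j
    refine (hi.add hj).mono' (by fun_prop) (Eventually.of_forall fun ω => ?_)
    simp only [Pi.add_apply, Real.norm_eq_abs]
    rw [abs_le]
    constructor <;> nlinarith [sq_nonneg (ξ i ω - ξ j ω), sq_nonneg (ξ i ω + ξ j ω)]
  have hm2 : ∀ i j, ∫ ω, ξ i ω * ξ j ω ∂P = if i = j then s else 0 := fun i j => by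
    split_ifs with hij
    · subst hij
      rw [← h2 i]
      congr 1; funext ω; ring
    · have := (hind.indepFun hij).integral_fun_mul_eq_mul_integral
        (hξ i).aestronglyMeasurable (hξ j).aestronglyMeasurable
      rw [this, h0, zero_mul]
  have hsq : ∀ ω, (∑ i, ∑ j, a i j * (ξ i ω * ξ j ω)) ^ 2 =
      ∑ i, ∑ j, ∑ k, ∑ l, a i j * a k l * (ξ i ω * ξ j ω * (ξ k ω * ξ l ω)) := fun ω => by
    rw [sq, Finset.sum_mul]
    refine Finset.sum_congr rfl fun i _ => ?_
    rw [Finset.sum_mul]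
    refine Finset.sum_congr rfl fun j _ => ?_
    rw [Finset.mul_sum]
    refine Finset.sum_congr rfl fun k _ => ?_
    rw [Finset.mul_sum]
    refine Finset.sum_congr rfl fun l _ => ?_
    ring
  have hint : ∀ i j k l, Integrable
      (fun ω => a i j * a k l * (ξ i ω * ξ j ω * (ξ k ω * ξ l ω))) P := fun i j k l =>
    (integrable_prod_four (hξ i) (hξ j) (hξ k) (hξ l) (hi4 i) (hi4 j) (hi4 k) (hi4 l)).const_mul _
  refine ⟨?_, ?_, ?_⟩
  · rw [integral_finsetSum _ fun i _ => integrable_finsetSum _ fun j _ => (hi2 i j).const_mul _,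
      Finset.mul_sum]
    refine Finset.sum_congr rfl fun i _ => ?_
    rw [integral_finsetSum _ fun j _ => (hi2 i j).const_mul _]
    simp_rw [integral_const_mul, hm2]
    simp [mul_comm]
  · simp_rw [hsq]
    exact integrable_finsetSum _ fun i _ => integrable_finsetSum _ fun j _ =>
      integrable_finsetSum _ fun k _ => integrable_finsetSum _ fun l _ => hint i j k l
  · simp_rw [hsq]
    have hval : ∀ i j k l, ∫ ω, a i j * a k l * (ξ i ω * ξ j ω * (ξ k ω * ξ l ω)) ∂P =
        κ * (if j = i then if k = i then if l = i then a i j * a k l else 0 else 0 else 0) +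
        s ^ 2 * ((if j = i then if l = k then a i j * a k l else 0 else 0) +
          (if k = i then if l = j then a i j * a k l else 0 else 0) +
          (if l = i then if k = j then a i j * a k l else 0 else 0)) := fun i j k l => by
      rw [integral_const_mul, integral_prod_four hξ hind h0 h2 h4]
      -- The equalities are oriented so that the sums over `l`, `k`, `j` collapse successively.
      simp only [eq_comm (a := i), eq_comm (a := k) (b := l), eq_comm (a := j) (b := l),
        eq_comm (a := j) (b := k), ite_and]
      split_ifs <;> ring
    rw [integral_finsetSum _ fun i _ => integrable_finsetSum _ fun j _ =>
      integrable_finsetSum _ fun k _ => integrable_finsetSum _ fun l _ => hint i j k l]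
    have h1 : ∀ i, ∫ ω, ∑ j, ∑ k, ∑ l, a i j * a k l * (ξ i ω * ξ j ω * (ξ k ω * ξ l ω)) ∂P =
        κ * a i i ^ 2 + s ^ 2 * (a i i * ∑ k, a k k + ∑ j, a i j ^ 2 + ∑ j, a i j ^ 2) := by
      intro i
      rw [integral_finsetSum _ fun j _ => integrable_finsetSum _ fun k _ =>
        integrable_finsetSum _ fun l _ => hint i j k l]
      have h1' : ∀ j, ∫ ω, ∑ k, ∑ l, a i j * a k l * (ξ i ω * ξ j ω * (ξ k ω * ξ l ω)) ∂P =
          κ * (if j = i then a i j * a i i else 0) + s ^ 2 *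
            ((if j = i then a i j * ∑ k, a k k else 0) + a i j * a i j + a i j * a j i) := by
        intro j
        rw [integral_finsetSum _ fun k _ => integrable_finsetSum _ fun l _ => hint i j k l]
        have h1'' : ∀ k, ∫ ω, ∑ l, a i j * a k l * (ξ i ω * ξ j ω * (ξ k ω * ξ l ω)) ∂P =
            κ * (if j = i then if k = i then a i j * a k i else 0 else 0) + s ^ 2 *
            ((if j = i then a i j * a k k else 0) + (if k = i then a i j * a k j else 0) +
              (if k = j then a i j * a k i else 0)) := by
          intro k
          rw [integral_finsetSum _ fun l _ => hint i j k l]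
          simp_rw [hval]
          rw [Finset.sum_add_distrib, ← Finset.mul_sum, ← Finset.mul_sum,
            Finset.sum_add_distrib, Finset.sum_add_distrib]
          congr 2
          · split_ifs <;> simp
          · congr 1
            · congr 1
              · split_ifs <;> simp
              · split_ifs <;> simp
            · simp
        simp_rw [h1'']
        rw [Finset.sum_add_distrib, ← Finset.mul_sum, ← Finset.mul_sum,
            Finset.sum_add_distrib, Finset.sum_add_distrib]
        congr 2
        · split_ifs <;> simp
        · congr 1
          · congr 1
            · split_ifs <;> simp [Finset.mul_sum]
            · simp
          · simp
      simp_rw [h1']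
      rw [Finset.sum_add_distrib, ← Finset.mul_sum, ← Finset.mul_sum,
            Finset.sum_add_distrib, Finset.sum_add_distrib]
      simp only [Finset.sum_ite_eq', Finset.mem_univ, if_true, ha _ i, ← sq]
    simp_rw [h1]
    rw [Finset.sum_add_distrib, ← Finset.mul_sum, ← Finset.mul_sum,
      Finset.sum_add_distrib, Finset.sum_add_distrib, ← Finset.sum_mul]
    ring

end FourthMoment

/-! ### The squared norm of the projection as a quadratic form. -/

section QuadraticForm

variable {d : ℕ} (S : Submodule ℝ (EuclideanSpace ℝ (Fin d)))

/-- The matrix of the projection. -/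
noncomputable def projMatrix (i j : Fin d) : ℝ :=
  S.starProjection (EuclideanSpace.single i (1 : ℝ)) j

lemma projMatrix_eq_inner (i j : Fin d) : projMatrix S i j =
    inner ℝ (S.starProjection (EuclideanSpace.single i (1 : ℝ)))
      (S.starProjection (EuclideanSpace.single j (1 : ℝ))) :=
  (inner_starProjection_single S _ j).symm

lemma projMatrix_comm (i j : Fin d) : projMatrix S i j = projMatrix S j i := by
  rw [projMatrix_eq_inner, projMatrix_eq_inner, real_inner_comm]

lemma projMatrix_self (i : Fin d) : projMatrix S i i =
    ‖S.starProjection (EuclideanSpace.single i (1 : ℝ))‖ ^ 2 := by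
  rw [projMatrix_eq_inner, real_inner_self_eq_norm_sq]

lemma sum_projMatrix_self : ∑ i, projMatrix S i i = projTrace S := by
  simp_rw [projMatrix_self]; rfl

lemma sum_projMatrix_sq : ∑ i, ∑ j, projMatrix S i j ^ 2 = projTrace S := by
  refine Finset.sum_congr rfl fun i _ => ?_
  rw [EuclideanSpace.norm_sq_eq]
  simp [projMatrix]

lemma sum_projMatrix_self_sq_le : ∑ i, projMatrix S i i ^ 2 ≤ projTrace S := by
  refine Finset.sum_le_sum fun i _ => ?_
  rw [projMatrix_self]
  have h1 := norm_starProjection_single_le S i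
  have h2 := norm_nonneg (S.starProjection (EuclideanSpace.single i (1 : ℝ)))
  exact pow_le_of_le_one (sq_nonneg _) (pow_le_one₀ h2 h1) two_ne_zero

lemma starProjection_eq_sum (x : EuclideanSpace ℝ (Fin d)) :
    S.starProjection x = ∑ i, x i • S.starProjection (EuclideanSpace.single i (1 : ℝ)) := by
  have h : x = ∑ i, x i • EuclideanSpace.single i (1 : ℝ) := by
    have := (EuclideanSpace.basisFun (Fin d) ℝ).sum_repr x
    simpa using this.symm
  conv_lhs => rw [h]
  simp only [map_sum, map_smul]

lemma norm_sq_starProjection (x : EuclideanSpace ℝ (Fin d)) :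
    ‖S.starProjection x‖ ^ 2 = ∑ i, ∑ j, projMatrix S i j * (x i * x j) := by
  rw [← real_inner_self_eq_norm_sq, starProjection_eq_sum, sum_inner]
  refine Finset.sum_congr rfl fun i _ => ?_
  rw [inner_sum]
  refine Finset.sum_congr rfl fun j _ => ?_
  rw [inner_smul_left, inner_smul_right, ← projMatrix_eq_inner]
  simp
  ring

lemma starProjection_eq_zero_of_projTrace (h : projTrace S = 0) (x : EuclideanSpace ℝ (Fin d)) :
    S.starProjection x = 0 := by
  have h1 := (Finset.sum_eq_zero_iff_of_nonneg fun i _ => sq_nonneg _).mp h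
  rw [starProjection_eq_sum]
  refine Finset.sum_eq_zero fun i hi => ?_
  have h2 := h1 i hi
  simp only [ne_eq, OfNat.ofNat_ne_zero, not_false_eq_true, pow_eq_zero_iff, norm_eq_zero] at h2
  rw [h2, smul_zero]

lemma projTrace_nonneg : 0 ≤ projTrace S := Finset.sum_nonneg fun _ _ => sq_nonneg _

end QuadraticForm

/-! ### One-dimensional marginals. -/

section Marginal

variable {Ω : Type*} [MeasurableSpace Ω] {P : Measure Ω} {d : ℕ} [NeZero d]
  {X : Ω → EuclideanSpace ℝ (Fin d)} {γ : EuclideanSpace ℝ (Fin d)} {ν : Measure ℝ}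

/-- The coordinates of an infinitely divisible vector are infinitely divisible. -/
lemma isID_marginal (hX : Measurable X) (hν : IsLevyMeasure ν)
    (hID : IsID (P.map X) γ (axisMeasure d ν)) :
    IsID (P.map fun ω => X ω 0) (γ 0) ν := by
  refine ⟨hν, fun t => ?_⟩
  have h := hID.charFun_eq (EuclideanSpace.single 0 t)
  have hX0 : Measurable fun ω => X ω 0 := by fun_prop
  have hinner : ∀ x : EuclideanSpace ℝ (Fin d), inner ℝ (EuclideanSpace.single 0 t) x = t * x 0 := by
    intro x; simp [EuclideanSpace.inner_single_left]
  have h1 : charFun (P.map X) (EuclideanSpace.single 0 t) = charFun (P.map fun ω => X ω 0) t := by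
    rw [charFun_apply, charFun_apply, integral_map hX.aemeasurable (by fun_prop),
      integral_map hX0.aemeasurable (by fun_prop)]
    congr 1; funext ω
    rw [real_inner_comm, hinner, real_inner_comm, inner_real_eq_mul]
  rw [← h1, h]
  congr 1
  -- Jumps along the other axes are orthogonal to the frequency vector and contribute nothing.
  have hz : ∀ k : Fin d, k ≠ 0 → ∀ u : ℝ, levyIntegrand (EuclideanSpace.single 0 t)
      (EuclideanSpace.single k u : EuclideanSpace ℝ (Fin d)) = 0 := by
    intro k hk u
    have hk' : (EuclideanSpace.single k u : EuclideanSpace ℝ (Fin d)) 0 = 0 := by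
      simp [hk.symm]
    unfold levyIntegrand
    rw [hinner, hk']
    by_cases hu : (EuclideanSpace.single k u : EuclideanSpace ℝ (Fin d)) ∈
        {v : EuclideanSpace ℝ (Fin d) | ‖v‖ ≤ 1}
    · rw [Set.indicator_of_mem hu, hinner, hk']; simp
    · rw [Set.indicator_of_notMem hu]; simp
  have h0 : ∀ u : ℝ, levyIntegrand (EuclideanSpace.single 0 t)
      (EuclideanSpace.single 0 u : EuclideanSpace ℝ (Fin d)) = levyIntegrand t u := by
    intro u
    have hu0 : (EuclideanSpace.single 0 u : EuclideanSpace ℝ (Fin d)) 0 = u := by simp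
    have hn : ‖(EuclideanSpace.single 0 u : EuclideanSpace ℝ (Fin d))‖ = ‖u‖ := by simp
    unfold levyIntegrand
    rw [hinner, hu0, inner_real_eq_mul]
    by_cases hu : ‖u‖ ≤ 1
    · rw [Set.indicator_of_mem (by simpa using hu), Set.indicator_of_mem (by exact hu), hinner, hu0,
        inner_real_eq_mul]
    · rw [Set.indicator_of_notMem (by simpa using hu), Set.indicator_of_notMem (by exact hu)]
  have hint := hID.isLevyMeasure.integrable_levyIntegrand (EuclideanSpace.single 0 t)
  rw [levyExponent_eq, levyExponent_eq, hinner, inner_real_eq_mul]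
  congr 1
  rw [axisMeasure, integrable_finsetSum_measure] at hint
  rw [axisMeasure, integral_finsetSum_measure hint, Finset.sum_eq_single 0]
  · rw [integral_map (measurable_single 0).aemeasurable
      (measurable_levyIntegrand _).aestronglyMeasurable]
    simp_rw [h0]
  · intro k _ hk
    rw [integral_map (measurable_single k).aemeasurable
      (measurable_levyIntegrand _).aestronglyMeasurable]
    simp_rw [hz k hk]
    simp
  · simp

end Marginal

/-! ### Cantelli's inequality and its comparison with an exponential. -/

section Deviation

/-- From `e^{-D} ≥ 1 - D`: for `A ≤ 3`, `(1 - A/4)(1 + A) ≥ 1`; for `A ≥ 3`, `1/(1 + A) ≤ 1/4 ≤ 1 -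
2/3`. -/
lemma one_div_one_add_le_exp_neg {A D : ℝ} (hA : 0 ≤ A) (h1 : D ≤ A / 4) (h2 : D ≤ 2 / 3) :
    1 / (1 + A) ≤ Real.exp (-D) := by
  have h3 := Real.add_one_le_exp (-D)
  refine le_trans ?_ h3
  rw [div_le_iff₀ (by linarith)]
  rcases le_total A 3 with h | h <;> nlinarith

variable {Ω : Type*} [MeasurableSpace Ω] {P : Measure Ω} [IsProbabilityMeasure P]

/-- Cantelli's inequality. -/
lemma measure_le_sub_le {Z : Ω → ℝ} {b V s : ℝ} (hZ : Integrable Z P) (hZb : ∫ ω, Z ω ∂P = b)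
    (hZ2 : Integrable (fun ω => (Z ω - b) ^ 2) P) (hV : ∫ ω, (Z ω - b) ^ 2 ∂P ≤ V) (hV0 : 0 < V)
    (hs : 0 < s) : P.real {ω | Z ω ≤ b - s} ≤ 1 / (1 + s ^ 2 / V) := by
  -- The shift that minimises Markov's bound `(V + l²)/(s + l)²`.
  set l := V / s with hl
  have hl0 : 0 < l := by positivity
  have hint : Integrable (fun ω => (b - Z ω + l) ^ 2) P := by
    have : ∀ ω, (b - Z ω + l) ^ 2 = (Z ω - b) ^ 2 + 2 * l * (b - Z ω) + l ^ 2 := fun ω => by ring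
    simp_rw [this]
    exact (hZ2.add (((integrable_const b).sub hZ).const_mul _)).add (integrable_const _)
  have hval : ∫ ω, (b - Z ω + l) ^ 2 ∂P ≤ V + l ^ 2 := by
    have h1 : ∀ ω, (b - Z ω + l) ^ 2 = (Z ω - b) ^ 2 + 2 * l * (b - Z ω) + l ^ 2 := fun ω => by ring
    have h2 : Integrable (fun ω => 2 * l * (b - Z ω)) P :=
      ((integrable_const b).sub hZ).const_mul _
    have h3 : Integrable (fun ω => (Z ω - b) ^ 2 + 2 * l * (b - Z ω)) P := hZ2.add h2
    simp_rw [h1]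
    rw [integral_add h3 (integrable_const _), integral_add hZ2 h2, integral_const_mul,
      integral_sub (integrable_const _) hZ, hZb]
    simpa using hV
  have hmarkov := mul_meas_ge_le_integral_of_nonneg (μ := P)
    (f := fun ω => (b - Z ω + l) ^ 2) (Eventually.of_forall fun ω => sq_nonneg _) hint ((s + l) ^ 2)
  have hsub : P.real {ω | Z ω ≤ b - s} ≤ P.real {ω | (s + l) ^ 2 ≤ (b - Z ω + l) ^ 2} :=
    measureReal_mono fun ω (hω : Z ω ≤ b - s) =>
      show (s + l) ^ 2 ≤ (b - Z ω + l) ^ 2 from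
        pow_le_pow_left₀ (by positivity) (by linarith) 2
  have hsl : 0 < (s + l) ^ 2 := by positivity
  have hfin : P.real {ω | Z ω ≤ b - s} ≤ (V + l ^ 2) / (s + l) ^ 2 := by
    rw [le_div_iff₀ hsl]
    nlinarith
  refine hfin.trans (le_of_eq ?_)
  rw [hl]
  field_simp
  ring

end Deviation

/-! ### Integrability from exponential moments. -/

section ExponentialMoments

variable {Ω : Type*} [MeasurableSpace Ω] {P : Measure Ω} [IsProbabilityMeasure P] {Y : Ω → ℝ}

lemma exists_integrable_exp_of_lt_expRadius {t : ℝ} (ht : (t : EReal) < expRadius P Y) :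
    ∃ t', t < t' ∧ 0 < t' ∧ Integrable (fun ω => Real.exp (t' * |Y ω|)) P := by
  unfold expRadius at ht
  rw [lt_sSup_iff] at ht
  obtain ⟨_, ⟨t', ⟨h0, hi⟩, rfl⟩, hlt⟩ := ht
  exact ⟨t', EReal.coe_lt_coe_iff.mp hlt, h0, hi⟩

lemma le_expRadius {t : ℝ} (ht : 0 < t) (hi : Integrable (fun ω => Real.exp (t * |Y ω|)) P) :
    (t : EReal) ≤ expRadius P Y :=
  le_sSup ⟨t, ⟨ht, hi⟩, rfl⟩

lemma integrable_pow_four_of_exp (hY : Measurable Y) {t : ℝ} (ht : 0 < t)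
    (hi : Integrable (fun ω => Real.exp (t * |Y ω|)) P) : Integrable (fun ω => Y ω ^ 4) P := by
  refine (hi.const_mul (24 / t ^ 4)).mono' (by fun_prop) (Eventually.of_forall fun ω => ?_)
  have h := Real.pow_div_factorial_le_exp (x := t * |Y ω|) (by positivity) 4
  have h24 : (Nat.factorial 4 : ℝ) = 24 := by norm_num [Nat.factorial]
  rw [h24, mul_pow] at h
  rw [Real.norm_eq_abs, abs_pow]
  calc |Y ω| ^ 4 = 24 / t ^ 4 * (t ^ 4 * |Y ω| ^ 4 / 24) := by field_simp
    _ ≤ 24 / t ^ 4 * Real.exp (t * |Y ω|) := by gcongr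

lemma integrable_mul_exp_sub_one (hY : Measurable Y) {t t' : ℝ} (htt' : t < t') (ht : 0 ≤ t)
    (hi : Integrable (fun ω => Real.exp (t' * |Y ω|)) P) :
    Integrable (fun ω => |Y ω| * (Real.exp (t * |Y ω|) - 1)) P := by
  have hδ : 0 < t' - t := by linarith
  refine (hi.const_mul (1 / (t' - t))).mono' (by fun_prop) (Eventually.of_forall fun ω => ?_)
  have h1 : 1 ≤ Real.exp (t * |Y ω|) := Real.one_le_exp (by positivity)
  have h2 : 0 ≤ Real.exp (t * |Y ω|) - 1 := by linarith
  rw [Real.norm_eq_abs, abs_of_nonneg (by positivity)]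
  have h3 := Real.add_one_le_exp ((t' - t) * |Y ω|)
  have h4 : Real.exp (t' * |Y ω|) = Real.exp ((t' - t) * |Y ω|) * Real.exp (t * |Y ω|) := by
    rw [← Real.exp_add]; congr 1; ring
  rw [h4]
  calc |Y ω| * (Real.exp (t * |Y ω|) - 1) ≤ |Y ω| * Real.exp (t * |Y ω|) := by gcongr; linarith
    _ = 1 / (t' - t) * (((t' - t) * |Y ω|) * Real.exp (t * |Y ω|)) := by field_simp
    _ ≤ _ := by gcongr; linarith

/-- The extra factor `|u|²` is absorbed by `e^{(t' - t)|u|}`. -/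
lemma integrable_pow_three_mul_exp_sub_one {ν : Measure ℝ} {t t' : ℝ} (htt' : t < t') (ht : 0 ≤ t)
    (hi : Integrable (fun u => |u| * (Real.exp (t' * |u|) - 1)) ν) :
    Integrable (fun u => |u| ^ 3 * (Real.exp (t * |u|) - 1)) ν := by
  have hδ : 0 < t' - t := by linarith
  refine (hi.const_mul (2 / (t' - t) ^ 2)).mono' (by fun_prop) (Eventually.of_forall fun u => ?_)
  have h1 : 1 ≤ Real.exp (t * |u|) := Real.one_le_exp (by positivity)
  have h2 : 0 ≤ Real.exp (t * |u|) - 1 := by linarith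
  rw [Real.norm_eq_abs, abs_of_nonneg (by positivity)]
  have h3 := Real.quadratic_le_exp_of_nonneg (x := (t' - t) * |u|) (by positivity)
  have h5 : 0 ≤ (t' - t) * |u| := by positivity
  have h4 : Real.exp (t' * |u|) = Real.exp ((t' - t) * |u|) * Real.exp (t * |u|) := by
    rw [← Real.exp_add]; congr 1; ring
  have h6 : ((t' - t) * |u|) ^ 2 / 2 * (Real.exp (t * |u|) - 1) ≤ Real.exp (t' * |u|) - 1 := by
    rw [h4]; nlinarith
  calc |u| ^ 3 * (Real.exp (t * |u|) - 1)
      = 2 / (t' - t) ^ 2 * (|u| * (((t' - t) * |u|) ^ 2 / 2 * (Real.exp (t * |u|) - 1))) := by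
        field_simp
    _ ≤ _ := by gcongr

lemma integrable_pow_four_of_pow_three {ν : Measure ℝ} {t : ℝ} (ht : 0 < t)
    (hi : Integrable (fun u => |u| ^ 3 * (Real.exp (t * |u|) - 1)) ν) :
    Integrable (fun u => u ^ 4) ν := by
  refine (hi.const_mul (1 / t)).mono' (by fun_prop) (Eventually.of_forall fun u => ?_)
  have h := Real.add_one_le_exp (t * |u|)
  rw [Real.norm_eq_abs, abs_pow]
  calc |u| ^ 4 = 1 / t * (|u| ^ 3 * (t * |u|)) := by field_simp
    _ ≤ _ := by gcongr; linarith

lemma IsLevyMeasure.integral_sq_pos {ν : Measure ℝ} (hν : IsLevyMeasure ν)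
    (hi : Integrable (fun u => u ^ 2) ν) : 0 < ∫ u, u ^ 2 ∂ν := by
  rw [integral_pos_iff_support_of_nonneg (fun u => sq_nonneg u) hi]
  have hsub : ({0}ᶜ : Set ℝ) ⊆ Function.support (fun u : ℝ => u ^ 2) := fun u hu =>
    pow_ne_zero 2 hu
  refine lt_of_lt_of_le ?_ (measure_mono hsub)
  rw [pos_iff_ne_zero]
  intro h0
  apply hν.ne_zero
  rw [← Measure.measure_univ_eq_zero, ← union_compl_self ({0} : Set ℝ)]
  exact measure_union_null hν.zero_atom h0

end ExponentialMoments

/-! ### Deviations of the projected norm. -/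

section Tails

variable {Ω : Type*} [MeasurableSpace Ω] {P : Measure Ω} [IsProbabilityMeasure P] {d : ℕ}
  {X : Ω → EuclideanSpace ℝ (Fin d)} (hX : Measurable X) (S : Submodule ℝ (EuclideanSpace ℝ (Fin d)))

include hX in
/-- First two moments of the norm of the projection. -/
lemma moments_norm_starProjection (hindep : iIndepFun (fun k ω => X ω k) P) {s κ : ℝ}
    (h0 : ∀ k, ∫ ω, X ω k ∂P = 0) (h2 : ∀ k, ∫ ω, X ω k ^ 2 ∂P = s)
    (hi4 : ∀ k, Integrable (fun ω => X ω k ^ 4) P)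
    (h4 : ∀ k, ∫ ω, X ω k ^ 4 ∂P = 3 * s ^ 2 + κ) (hκ : 0 ≤ κ) :
    Integrable (fun ω => ‖S.starProjection (X ω)‖ ^ 2) P ∧
    ∫ ω, ‖S.starProjection (X ω)‖ ^ 2 ∂P = s * projTrace S ∧
    Integrable (fun ω => (‖S.starProjection (X ω)‖ ^ 2 - s * projTrace S) ^ 2) P ∧
    ∫ ω, (‖S.starProjection (X ω)‖ ^ 2 - s * projTrace S) ^ 2 ∂P ≤
      projTrace S * (κ + 2 * s ^ 2) := by
  have hmeas : ∀ k, Measurable fun ω => X ω k := fun k => by fun_prop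
  obtain ⟨e1, i2, e2⟩ := integral_quadratic_form (ξ := fun k ω => X ω k) hmeas hindep h0 h2 hi4 h4
    (projMatrix S) (projMatrix_comm S)
  simp_rw [← norm_sq_starProjection] at e1 i2 e2
  rw [sum_projMatrix_self] at e1 e2
  rw [sum_projMatrix_sq] at e2
  have hm : Measurable fun ω => ‖S.starProjection (X ω)‖ ^ 2 := by
    have := S.starProjection.continuous.measurable
    fun_prop
  have i1 : Integrable (fun ω => ‖S.starProjection (X ω)‖ ^ 2) P := by
    refine (i2.add (integrable_const (1 : ℝ))).mono' hm.aestronglyMeasurable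
      (Eventually.of_forall fun ω => ?_)
    simp only [Pi.add_apply, Real.norm_eq_abs]
    rw [abs_of_nonneg (sq_nonneg _)]
    nlinarith [sq_nonneg (‖S.starProjection (X ω)‖ ^ 2 - 1), sq_nonneg ‖S.starProjection (X ω)‖]
  have hexp : ∀ ω, (‖S.starProjection (X ω)‖ ^ 2 - s * projTrace S) ^ 2 =
      (‖S.starProjection (X ω)‖ ^ 2) ^ 2 - 2 * (s * projTrace S) * ‖S.starProjection (X ω)‖ ^ 2 +
        (s * projTrace S) ^ 2 := fun ω => by ring
  have i3 : Integrable (fun ω => (‖S.starProjection (X ω)‖ ^ 2) ^ 2 -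
      2 * (s * projTrace S) * ‖S.starProjection (X ω)‖ ^ 2) P := i2.sub (i1.const_mul _)
  refine ⟨i1, e1, ?_, ?_⟩
  · simp_rw [hexp]
    exact i3.add (integrable_const _)
  · simp_rw [hexp]
    rw [integral_add i3 (integrable_const _), integral_sub i2 (i1.const_mul _), integral_const_mul,
      e1, e2, integral_const, probReal_univ, one_smul]
    have := mul_le_mul_of_nonneg_left (sum_projMatrix_self_sq_le S) hκ
    nlinarith

variable {γ : EuclideanSpace ℝ (Fin d)} {ν : Measure ℝ} {K m : ℝ} {M : EReal}

lemma truncNorm_nonneg (c : ℝ) (x : EuclideanSpace ℝ (Fin d)) : 0 ≤ truncNorm S c x :=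
  (norm_nonneg _).trans (le_max_left _ _)

include hX in
/-- Exponential deviation bounds for the norm of the projection. -/
lemma tails_norm_starProjection (hID : IsID (P.map X) γ (axisMeasure d ν)) (hK0 : 0 ≤ K)
    (hint : ∀ t ∈ ico M,
      Integrable (fun u => (8 + K * u ^ 2) * (|u| * (Real.exp (t * |u|) - 1))) ν)
    (hq2 : Integrable (fun u => (8 + K * u ^ 2) * u ^ 2) ν)
    (hm : 0 < m) {ε : ℝ} (hε : 0 < ε) (hK : 2 * projTrace S ≤ K * (ε * m) ^ 2)
    (i1 : Integrable (fun ω => ‖S.starProjection (X ω)‖ ^ 2) P)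
    (e1 : ∫ ω, ‖S.starProjection (X ω)‖ ^ 2 ∂P = m ^ 2)
    (i2 : Integrable (fun ω => (‖S.starProjection (X ω)‖ ^ 2 - m ^ 2) ^ 2) P)
    (e2 : ε < 1 → ∫ ω, (‖S.starProjection (X ω)‖ ^ 2 - m ^ 2) ^ 2 ∂P ≤
      m ^ 2 * (∫ u, (8 + K * u ^ 2) * u ^ 2 ∂ν) / 2)
    (hv : 0 < ∫ u, (8 + K * u ^ 2) * u ^ 2 ∂ν)
    {t x : ℝ} (ht : t ∈ ico M) (ht0 : 0 < t) (hx : 0 < x) :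
    P.real {ω | (1 + ε) * m + x ≤ ‖S.starProjection (X ω)‖} ≤
      Real.exp (-(x * t - weightedExponent ν (fun u => 8 + K * u ^ 2) t)) ∧
    P.real {ω | ‖S.starProjection (X ω)‖ ≤ (1 - ε) * m - x} ≤
      Real.exp (-(x * t - weightedExponent ν (fun u => 8 + K * u ^ 2) t)) := by
  set q : ℝ → ℝ := fun u => 8 + K * u ^ 2 with hq
  have hqc : Continuous q := by fun_prop
  have hqpos : ∀ u, 0 < q u := fun u => by positivity
  set W := weightedExponent ν q t with hW
  have hW0 : 0 ≤ W := weightedExponent_nonneg hqpos t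
  set c := ε * m with hc
  have hc0 : 0 < c := by positivity
  have := Measure.isProbabilityMeasure_map (μ := P) hX.aemeasurable
  set r : Ω → ℝ := fun ω => ‖S.starProjection (X ω)‖ with hr
  have hr0 : ∀ ω, 0 ≤ r ω := fun ω => norm_nonneg _
  have hrm : Measurable r := by
    have := S.starProjection.continuous.measurable
    fun_prop
  have ir : Integrable r P := by
    refine (i1.add (integrable_const (1 : ℝ))).mono' hrm.aestronglyMeasurable
      (Eventually.of_forall fun ω => ?_)
    simp only [Pi.add_apply, Real.norm_eq_abs]
    rw [abs_of_nonneg (hr0 ω)]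
    nlinarith [sq_nonneg (r ω - 1)]
  have iF : Integrable (fun ω => max (r ω) c) P := ir.sup (integrable_const c)
  have hFm : Measurable (truncNorm S c) := (continuous_truncNorm S c).measurable
  have iFμ : Integrable (truncNorm S c) (P.map X) := by
    rw [integrable_map_measure hFm.aestronglyMeasurable hX.aemeasurable]
    exact iF
  have eF : ∫ y, truncNorm S c y ∂(P.map X) = ∫ ω, max (r ω) c ∂P :=
    integral_map hX.aemeasurable hFm.aestronglyMeasurable
  have hup := measure_ge_le_exp hqc hqpos hint hID (continuous_truncNorm S c) (truncNorm_nonneg S c)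
    iFμ (abs_truncNorm_add_single_sub_le S c) (sum_sq_truncNorm_sub_le S hc0 hK) ht ht0
  have hlow := measure_le_le_exp hqc hqpos hint hID (continuous_truncNorm S c)
    (truncNorm_nonneg S c) iFμ (abs_truncNorm_add_single_sub_le S c)
    (sum_sq_truncNorm_sub_le S hc0 hK) ht ht0
  rw [eF] at hup hlow
  have hup' : ∀ y, P.real {ω | y ≤ max (r ω) c} ≤
      Real.exp (-t * (y - ∫ ω, max (r ω) c ∂P) + W / 4) := fun y => by
    refine le_trans (le_of_eq ?_) (hup y)
    rw [map_measureReal_apply hX (measurableSet_le measurable_const hFm)]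
    rfl
  have hlow' : ∀ y, P.real {ω | max (r ω) c ≤ y} ≤
      Real.exp (-t * (∫ ω, max (r ω) c ∂P - y) + W / 4) := fun y => by
    refine le_trans (le_of_eq ?_) (hlow y)
    rw [map_measureReal_apply hX (measurableSet_le hFm measurable_const)]
    rfl
  constructor
  · have hr1 : ∫ ω, r ω ∂P ≤ m := by
      -- The inequality `r ≤ r²/(2m) + m/2` plays the role of Cauchy–Schwarz for `E r ≤ m`.
      calc ∫ ω, r ω ∂P ≤ ∫ ω, (r ω ^ 2 / (2 * m) + m / 2) ∂P := by
            refine integral_mono ir ((i1.div_const _).add (integrable_const _)) fun ω => ?_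
            have h1 : r ω ^ 2 / (2 * m) + m / 2 - r ω = (r ω - m) ^ 2 / (2 * m) := by
              field_simp; ring
            have h2 : 0 ≤ (r ω - m) ^ 2 / (2 * m) := by positivity
            show r ω ≤ r ω ^ 2 / (2 * m) + m / 2
            linarith
        _ = m := by
            rw [integral_add (i1.div_const _) (integrable_const _), integral_div, e1, integral_const,
              probReal_univ, one_smul]
            field_simp; norm_num
    have hF1 : ∫ ω, max (r ω) c ∂P ≤ (1 + ε) * m := by
      calc ∫ ω, max (r ω) c ∂P ≤ ∫ ω, (r ω + c) ∂P := by
            refine integral_mono iF (ir.add (integrable_const _)) fun ω => ?_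
            exact max_le (by linarith) (by linarith [hr0 ω])
        _ ≤ (1 + ε) * m := by
            rw [integral_add ir (integrable_const _), integral_const, probReal_univ, one_smul]
            linarith
    calc P.real {ω | (1 + ε) * m + x ≤ r ω} ≤ P.real {ω | (1 + ε) * m + x ≤ max (r ω) c} :=
          measureReal_mono fun ω (hω : (1 + ε) * m + x ≤ r ω) =>
            show (1 + ε) * m + x ≤ max (r ω) c from hω.trans (le_max_left _ _)
      _ ≤ _ := hup' _
      _ ≤ _ := by
          apply Real.exp_le_exp.mpr
          nlinarith
  · set a := (1 - ε) * m - x with ha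
    rcases lt_or_ge a 0 with ha0 | ha0
    · have : {ω | r ω ≤ a} = ∅ := by
        ext ω
        simp only [mem_ofPred_eq, mem_empty_iff_false, iff_false, not_le]
        linarith [hr0 ω]
      rw [this, measureReal_empty]
      exact (Real.exp_pos _).le
    have hε1 : ε < 1 := by
      by_contra h
      push Not at h
      nlinarith
    set v := ∫ u, q u * u ^ 2 ∂ν with hvdef
    set V := ∫ ω, (r ω ^ 2 - m ^ 2) ^ 2 ∂P with hV
    have hVv : V ≤ m ^ 2 * v / 2 := e2 hε1
    have hWv : v * t ^ 2 / 2 ≤ W := sq_mul_le_weightedExponent hqc hqpos hint ht hq2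
    have hxm : x ≤ m := by nlinarith
    set δ := v / (4 * m) with hδ
    -- A pointwise Taylor bound of `√(r²)` around `m²`, with quadratic remainder; the linear term
    -- has mean zero and the remainder is controlled by `V ≤ m² v/2`.
    have hr2 : m - δ ≤ ∫ ω, r ω ∂P := by
      have hpt : ∀ ω, m - (m ^ 2 - r ω ^ 2) / (2 * m) - (r ω ^ 2 - m ^ 2) ^ 2 / (2 * m ^ 3) ≤
          r ω := fun ω => by
        have h1 : r ω - (m - (m ^ 2 - r ω ^ 2) / (2 * m) - (r ω ^ 2 - m ^ 2) ^ 2 / (2 * m ^ 3)) =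
            r ω * (r ω - m) ^ 2 * (r ω + 2 * m) / (2 * m ^ 3) := by
          field_simp; ring
        have h2 : 0 ≤ r ω * (r ω - m) ^ 2 * (r ω + 2 * m) / (2 * m ^ 3) := by
          have := hr0 ω
          positivity
        linarith
      have j1 : Integrable (fun ω => (m ^ 2 - r ω ^ 2) / (2 * m)) P :=
        ((integrable_const _).sub i1).div_const _
      have j2 : Integrable (fun ω => m - (m ^ 2 - r ω ^ 2) / (2 * m)) P :=
        (integrable_const _).sub j1
      have j3 : Integrable (fun ω => (r ω ^ 2 - m ^ 2) ^ 2 / (2 * m ^ 3)) P := i2.div_const _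
      have h3 := integral_mono (j2.sub j3) ir hpt
      have h4 : ∫ ω, (m - (m ^ 2 - r ω ^ 2) / (2 * m) - (r ω ^ 2 - m ^ 2) ^ 2 / (2 * m ^ 3)) ∂P =
          m - V / (2 * m ^ 3) := by
        rw [integral_sub j2 j3, integral_sub (integrable_const _) j1, integral_div, integral_div,
          integral_sub (integrable_const _) i1, e1]
        simp [hV]
      have h5 : V / (2 * m ^ 3) ≤ δ := by
        rw [hδ, div_le_div_iff₀ (by positivity) (by positivity)]
        nlinarith
      have h6 : m - V / (2 * m ^ 3) ≤ ∫ ω, r ω ∂P := h4 ▸ h3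
      linarith
    have hF2 : m - δ ≤ ∫ ω, max (r ω) c ∂P :=
      hr2.trans (integral_mono ir iF fun ω => le_max_left _ _)
    -- Chernoff's bound costs only `W/4` out of the allowed `W`, so a loss `tδ` of up to `3W/4` in
    -- the mean is harmless.
    rcases le_or_gt (t * δ) (3 / 4 * W) with hcase | hcase
    · calc P.real {ω | r ω ≤ a} ≤ P.real {ω | max (r ω) c ≤ max a c} :=
            measureReal_mono fun ω (hω : r ω ≤ a) =>
              show max (r ω) c ≤ max a c from max_le_max_right c hω
        _ ≤ _ := hlow' _
        _ ≤ _ := by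
            apply Real.exp_le_exp.mpr
            -- Nonnegativity of `a` means `x ≤ (1 - ε) m`, so the floor `c = εm` does not exceed `m
            -- - x`.
            have h1 : max a c ≤ m - x := by
              apply max_le
              · rw [ha]; nlinarith
              · rw [hc]; linarith
            have h2 : t * (x - δ) ≤ t * (∫ ω, max (r ω) c ∂P - max a c) := by
              apply mul_le_mul_of_nonneg_left _ ht0.le
              linarith
            linarith
    -- Failure of the first case, with `W ≥ v t²/2` and `δ = v/(4m)`, bounds `t m`; the target
    -- exponent is then at most `2/3`.
    · have htm : t * m ≤ 2 / 3 := by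
        have h1 : 3 / 8 * v * t ^ 2 < t * δ := by linarith
        have h2 : t * δ * (4 * m) = t * v := by rw [hδ]; field_simp
        have h3 : 3 / 8 * v * t ^ 2 * (4 * m) < t * v := by
          rw [← h2]; gcongr
        have h4 : (t * v) * (3 / 2 * (t * m)) < (t * v) * 1 := by linarith
        have h5 := lt_of_mul_lt_mul_left h4 (by positivity)
        linarith
      have hD1 : x * t - W ≤ 2 / 3 := by
        have : x * t ≤ m * t := by gcongr
        linarith
      have hVpos : 0 < m ^ 2 * v / 2 := by positivity
      -- Maximising `x t - v t²/2` over `t` gives `x²/(2v)`, a quarter of the ratio in Cantelli's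
      -- inequality.
      have hD2 : x * t - W ≤ (x * m) ^ 2 / (m ^ 2 * v / 2) / 4 := by
        have h1 : (x * m) ^ 2 / (m ^ 2 * v / 2) / 4 = x ^ 2 / (2 * v) := by
          field_simp; norm_num
        rw [h1, le_div_iff₀ (by positivity)]
        nlinarith [sq_nonneg (x - v * t)]
      have hcant := measure_le_sub_le (Z := fun ω => r ω ^ 2) i1 e1 i2 hVv hVpos
        (s := x * m) (by positivity)
      have hsub : {ω | r ω ≤ a} ⊆ {ω | r ω ^ 2 ≤ m ^ 2 - x * m} := by
        intro ω hω
        simp only [mem_ofPred_eq] at hω ⊢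
        have h1 : r ω ≤ m - x := by rw [ha] at hω; linarith
        have h2 : r ω ^ 2 ≤ (m - x) ^ 2 := pow_le_pow_left₀ (hr0 ω) h1 2
        nlinarith
      exact ((measureReal_mono hsub).trans hcant).trans
        (one_div_one_add_le_exp_neg (by positivity) hD2 hD1)

end Tails

end IDConcentration

theorem corollary4 {Ω : Type*} [MeasurableSpace Ω] (P : Measure Ω) [IsProbabilityMeasure P]
    (d : ℕ) [NeZero d] (X : Ω → EuclideanSpace ℝ (Fin d)) (hX : Measurable X)
    (γ : EuclideanSpace ℝ (Fin d)) (ν : Measure ℝ)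
    -- `X ~ ID(γ, 0, ⋅)` with i.i.d. coordinates, `ν` being the Lévy measure of each coordinate
    (hν : IDConcentration.IsLevyMeasure ν)
    (hID : IDConcentration.IsID (P.map X) γ (IDConcentration.axisMeasure d ν))
    (hindep : iIndepFun (fun k ω => X ω k) P)
    (hident : ∀ k, IdentDistrib (fun ω => X ω k) (fun ω => X ω 0) P P)
    (hcentered : ∫ ω, X ω 0 ∂P = 0)
    (hexp : ∃ t : ℝ, 0 < t ∧ Integrable (fun ω => Real.exp (t * ‖X ω‖)) P)
    (S : Submodule ℝ (EuclideanSpace ℝ (Fin d))) (ε : ℝ) (hε : 0 < ε)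
    (M : EReal) (hM : M = IDConcentration.expRadius P (fun ω => X ω 0))
    (h : ℝ → ℝ) (hh : h = IDConcentration.hFun P (fun ω => X ω 0) ν ε) :
    -- `h` is well defined and finite on `[0, M)`
    (∀ t ∈ IDConcentration.ico M,
      Integrable (fun u => |u| * (Real.exp (t * |u|) - 1)) ν ∧
      Integrable (fun u => |u| ^ 3 * (Real.exp (t * |u|) - 1)) ν) ∧
    -- `h` is increasing, with an inverse defined on `[0, h(M⁻))`
    StrictMonoOn h (IDConcentration.ico M) ∧
    Set.BijOn h (IDConcentration.ico M)
      (IDConcentration.ico (IDConcentration.leftLimit h M)) ∧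
    -- the two tail bounds
    ∀ x : ℝ, 0 < x → (x : EReal) < IDConcentration.leftLimit h M →
      P.real {ω | (1 + ε) * Real.sqrt (∫ ω', ‖S.starProjection (X ω')‖ ^ 2 ∂P) + x
          ≤ ‖S.starProjection (X ω)‖}
        ≤ Real.exp (-∫ s in (0 : ℝ)..x, IDConcentration.inverseOn h M s) ∧
      P.real {ω | ‖S.starProjection (X ω)‖
          ≤ (1 - ε) * Real.sqrt (∫ ω', ‖S.starProjection (X ω')‖ ^ 2 ∂P) - x}
        ≤ Real.exp (-∫ s in (0 : ℝ)..x, IDConcentration.inverseOn h M s) := by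
  subst hM hh
  set Y : Ω → ℝ := fun ω => X ω 0 with hY
  have hYm : Measurable Y := by fun_prop
  set M := IDConcentration.expRadius P Y with hMdef
  -- exponential moments
  obtain ⟨t₀, ht₀, hi₀⟩ := hexp
  have hiY : Integrable (fun ω => Real.exp (t₀ * |Y ω|)) P := by
    refine hi₀.mono' (by fun_prop) (Filter.Eventually.of_forall fun ω => ?_)
    rw [Real.norm_eq_abs, Real.abs_exp]
    apply Real.exp_le_exp.mpr
    have : |Y ω| ≤ ‖X ω‖ := PiLp.norm_apply_le (X ω) 0
    gcongr
  have hMt₀ : (t₀ : EReal) ≤ M := IDConcentration.le_expRadius ht₀ hiY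
  have hMpos : 0 < M := lt_of_lt_of_le (by exact_mod_cast ht₀) hMt₀
  have hhalf : t₀ / 2 ∈ IDConcentration.ico M :=
    ⟨by positivity, lt_of_lt_of_le (EReal.coe_lt_coe_iff.mpr (by linarith)) hMt₀⟩
  -- moments of the marginal law
  have hID₁ := IDConcentration.isID_marginal hX hν hID
  have := Measure.isProbabilityMeasure_map (μ := P) hYm.aemeasurable
  have hY4 : Integrable (fun ω => Y ω ^ 4) P :=
    IDConcentration.integrable_pow_four_of_exp hYm ht₀ hiY
  obtain ⟨hY1, hY2⟩ := IDConcentration.integrable_pow_of_pow_four hYm hY4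
  have mint : ∀ {g : ℝ → ℝ}, Measurable g → Integrable (fun ω => g (Y ω)) P →
      Integrable g (P.map Y) := fun hg hi =>
    (integrable_map_measure hg.aestronglyMeasurable hYm.aemeasurable).mpr hi
  have mval : ∀ {g : ℝ → ℝ}, Measurable g → ∫ y, g y ∂(P.map Y) = ∫ ω, g (Y ω) ∂P := fun hg =>
    integral_map hYm.aemeasurable hg.aestronglyMeasurable
  have μ1 : Integrable (fun y : ℝ => y) (P.map Y) := mint measurable_id hY1
  have μ2 : Integrable (fun y : ℝ => y ^ 2) (P.map Y) := mint (by fun_prop) hY2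
  have μ4 : Integrable (fun y : ℝ => y ^ 4) (P.map Y) := mint (by fun_prop) hY4
  have μ0 : ∫ y, y ∂(P.map Y) = 0 := by
    rw [mval (g := fun y => y) measurable_id]; exact hcentered
  have hν2 := hID₁.integrable_sq μ2 μ1 μ0
  set s := ∫ ω, Y ω ^ 2 ∂P with hs
  have hsν : s = ∫ u, u ^ 2 ∂ν := by
    rw [← hID₁.integral_sq μ2 μ1 μ0, mval (by fun_prop)]
  have hspos : 0 < s := by rw [hsν]; exact hν.integral_sq_pos hν2
  -- integrability with respect to the Lévy measure
  have hint1 : ∀ t ∈ IDConcentration.ico M,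
      Integrable (fun u => |u| * (Real.exp (t * |u|) - 1)) ν := by
    intro t ht
    rcases ht.1.eq_or_lt with h0 | h0
    -- At `t = 0` the integrand vanishes identically.
    · simp [← h0]
    · obtain ⟨t', htt', -, hi'⟩ := IDConcentration.exists_integrable_exp_of_lt_expRadius ht.2
      exact hID₁.integrable_mul_exp μ2 μ1 μ0 h0 (mint (by fun_prop)
        (IDConcentration.integrable_mul_exp_sub_one hYm htt' ht.1 hi'))
  have hint3 : ∀ t ∈ IDConcentration.ico M,
      Integrable (fun u => |u| ^ 3 * (Real.exp (t * |u|) - 1)) ν := by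
    intro t ht
    obtain ⟨t', ht', htt'⟩ := IDConcentration.exists_gt_mem_ico ht
    exact IDConcentration.integrable_pow_three_mul_exp_sub_one htt' ht.1 (hint1 t' ht')
  have hν4 : Integrable (fun u => u ^ 4) ν :=
    IDConcentration.integrable_pow_four_of_pow_three (by positivity) (hint3 _ hhalf)
  set κ := ∫ u, u ^ 4 ∂ν with hκ
  have hκ0 : 0 ≤ κ := integral_nonneg fun u => by positivity
  have hY4val : ∫ ω, Y ω ^ 4 ∂P = 3 * s ^ 2 + κ := by
    have := hID₁.integral_pow_four μ2 μ1 μ0 μ4 hν4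
    rwa [mval (by fun_prop), mval (by fun_prop)] at this
  -- the function `h` as a weighted integral
  set K := 2 / (ε ^ 2 * s) with hK
  have hK0 : 0 < K := by positivity
  set q : ℝ → ℝ := fun u => 8 + K * u ^ 2 with hq
  have hqc : Continuous q := by fun_prop
  have hqpos : ∀ u, 0 < q u := fun u => by positivity
  have hsplit : ∀ t u : ℝ, q u * (|u| * (Real.exp (t * |u|) - 1)) =
      8 * (|u| * (Real.exp (t * |u|) - 1)) + K * (|u| ^ 3 * (Real.exp (t * |u|) - 1)) := by
    intro t u
    simp only [hq]
    rw [← sq_abs u]; ring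
  have hint : ∀ t ∈ IDConcentration.ico M,
      Integrable (fun u => q u * (|u| * (Real.exp (t * |u|) - 1))) ν := by
    intro t ht
    simp_rw [hsplit]
    exact ((hint1 t ht).const_mul 8).add ((hint3 t ht).const_mul K)
  set h := IDConcentration.hFun P Y ν ε with hh
  have hweighted : EqOn (IDConcentration.weightedDeriv ν q) h (IDConcentration.ico M) := by
    intro t ht
    rw [IDConcentration.weightedDeriv]
    simp_rw [hsplit]
    rw [integral_add ((hint1 t ht).const_mul 8) ((hint3 t ht).const_mul K), integral_const_mul,
      integral_const_mul]
    rfl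
  have hzero : (0 : ℝ) ∈ IDConcentration.ico M := ⟨le_rfl, by exact_mod_cast hMpos⟩
  have h0 : h 0 = 0 := by rw [← hweighted hzero, IDConcentration.weightedDeriv_zero]
  have hmono : StrictMonoOn h (IDConcentration.ico M) :=
    (IDConcentration.strictMonoOn_weightedDeriv hqpos hint hν).congr hweighted
  have hcont : ContinuousOn h (IDConcentration.ico M) :=
    (IDConcentration.continuousOn_weightedDeriv hqc hqpos hint).congr hweighted.symm
  have hbij := IDConcentration.bijOn_ico_leftLimit hMpos h0 hmono hcont
  refine ⟨fun t ht => ⟨hint1 t ht, hint3 t ht⟩, hmono, hbij, fun x hx hxL => ?_⟩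
  have hxm : x ∈ IDConcentration.ico (IDConcentration.leftLimit h M) := ⟨hx.le, hxL⟩
  have hyoung := IDConcentration.integral_inverseOn_le hbij hmono h0 hMpos
    (H := IDConcentration.weightedExponent ν q) IDConcentration.weightedExponent_zero
    (fun a ha b hb => by
      rw [← hweighted ha]
      exact IDConcentration.weightedDeriv_mul_le hqc hqpos hint ha hb) hx hxL
  set t := IDConcentration.inverseOn h M x with ht
  have htm : t ∈ IDConcentration.ico M := IDConcentration.inverseOn_mem hbij hxm
  have ht0 : 0 < t := by
    rw [← hmono.lt_iff_lt hzero htm, h0, ht, IDConcentration.apply_inverseOn hbij hxm]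
    exact hx
  -- moments of the projection
  have hc0 : ∀ k, ∫ ω, X ω k ∂P = 0 := fun k => by
    rw [(hident k).integral_eq]; exact hcentered
  have hc2 : ∀ k, ∫ ω, X ω k ^ 2 ∂P = s := fun k =>
    ((hident k).comp (u := fun y : ℝ => y ^ 2) (by fun_prop)).integral_eq
  have hc4i : ∀ k, Integrable (fun ω => X ω k ^ 4) P := fun k =>
    ((hident k).comp (u := fun y : ℝ => y ^ 4) (by fun_prop)).integrable_iff.mpr hY4
  have hc4 : ∀ k, ∫ ω, X ω k ^ 4 ∂P = 3 * s ^ 2 + κ := fun k => by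
    rw [← hY4val]
    exact ((hident k).comp (u := fun y : ℝ => y ^ 4) (by fun_prop)).integral_eq
  obtain ⟨i1, e1, i2, e2⟩ := IDConcentration.moments_norm_starProjection hX S hindep hc0 hc2 hc4i
    hc4 hκ0
  set T := IDConcentration.projTrace S with hT
  rcases (IDConcentration.projTrace_nonneg S).eq_or_lt with hT0 | hTpos
  -- For a zero projection both events are empty, because `x > 0`.
  · have hz : ∀ y, S.starProjection y = 0 :=
      IDConcentration.starProjection_eq_zero_of_projTrace S hT0.symm
    have h1 : ¬ (x ≤ 0) := not_le.mpr hx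
    constructor <;> simp [hz, h1, Real.exp_nonneg]
  have hTpos' : 0 < T := hTpos
  set m := √(s * T) with hm
  have hmpos : 0 < m := Real.sqrt_pos.mpr (by positivity)
  have hmsq : m ^ 2 = s * T := Real.sq_sqrt (by positivity)
  have hq2split : ∀ u, q u * u ^ 2 = 8 * u ^ 2 + K * u ^ 4 := fun u => by simp only [hq]; ring
  have hq2 : Integrable (fun u => q u * u ^ 2) ν := by
    simp_rw [hq2split]
    exact (hν2.const_mul 8).add (hν4.const_mul K)
  have hv : ∫ u, q u * u ^ 2 ∂ν = 8 * s + K * κ := by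
    simp_rw [hq2split]
    rw [integral_add (hν2.const_mul 8) (hν4.const_mul K), integral_const_mul, integral_const_mul,
      hsν]
  rw [e1, ← hm]
  obtain ⟨hu, hl⟩ := IDConcentration.tails_norm_starProjection hX S hID hK0.le hint hq2 hmpos hε
    (by
      -- As `(εm)² = ε² s T`, the coefficient in `h` is exactly the `K` for which `2T = K (εm)²`.
      rw [mul_pow, hmsq, hK]
      apply le_of_eq
      field_simp
      exact hT.symm) i1 (by rw [hmsq]; exact e1) (by rw [hmsq]; exact i2)
    (fun hε1 => by
      rw [hmsq]
      refine e2.trans ?_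
      change T * (κ + 2 * s ^ 2) ≤ s * T * (∫ u, q u * u ^ 2 ∂ν) / 2
      rw [hv]
      -- Here `K s = 2/ε²`, so `ε < 1` makes the term `K s κ/2` dominate the fourth cumulant `κ`.
      have hKs : 2 ≤ K * s := by
        rw [hK, div_mul_eq_mul_div, le_div_iff₀ (by positivity)]
        have : ε ^ 2 ≤ 1 := pow_le_one₀ hε.le hε1.le
        nlinarith
      have h1 : 2 * κ ≤ K * s * κ := by gcongr
      have h2 : T * (2 * κ) ≤ T * (K * s * κ) := by gcongr
      nlinarith [mul_pos hTpos' (pow_pos hspos 2)])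
    (by
      change 0 < ∫ u, q u * u ^ 2 ∂ν
      rw [hv]; positivity) htm ht0 hx
  have hfinal : Real.exp (-(x * t - IDConcentration.weightedExponent ν q t)) ≤
      Real.exp (-∫ s in (0 : ℝ)..x, IDConcentration.inverseOn h M s) :=
    Real.exp_le_exp.mpr (neg_le_neg hyoung)
  exact ⟨hu.trans hfinal, hl.trans hfinal⟩
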